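/- Let $d,p\ge 1$, let $(X_i)_{i\ge 1}$ be a sequence of random vectors in $\mathbb{R}^d$, let $x_1,\dots,x_p\in\mathbb{R}^d$ be fixed points, and put $Y_i=(\mathbf 1(X_i\le x_1),\dots,\mathbf 1(X_i\le x_p))\in\mathbb{R}^p$, where inequalities between vectors are componentwise. For $0\le j<k$ let $F_{j+1:k}=\frac1{k-j}\sum_{i=j+1}^k Y_i$ be the vector of values at $x_1,\dots,x_p$ of the empirical distribution function of $X_{j+1},\dots,X_k$. For a $p\times p$ matrix $M$ and $y\in\mathbb{R}^p$ write $\|y\|_M=\sqrt{y^\top M y/p}$. For each $m\ge 1$ let $\Sigma_m$ be a $p\times p$ matrix that is a function of $Y_1,\dots,Y_m$, and define $$D_m(k)=\max_{m\le j<k}\frac{j(k-j)}{m^{3/2}}\,\|F_{1:j}-F_{j+1:k}\|_{\Sigma_m^{-1}},\qquad k>m$$ (on the event, of asymptotically vanishing probability below, that $\Sigma_m$ is singular or $y^\top\Sigma_m^{-1}y<0$ for the relevant $y$, use any fixed convention, here $\Sigma_m^{-1}=0$ and $\sqrt{r}=0$ for $r<0$). Assume the following strong approximation condition: there exists a probability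 space on which are defined a sequence with the same law as $(Y_i)_{i\ge1}$ (again denoted by $(Y_i)$), which is strictly stationary and whose long-run covariance matrix $$\Sigma=\mathrm{Cov}(Y_1,Y_1)+\sum_{i=2}^\infty\{\mathrm{Cov}(Y_1,Y_i)+\mathrm{Cov}(Y_i,Y_1)\}$$ exists and is positive definite, and, for each $m\ge 1$, two independent $p$-dimensional standard Brownian motions $W_{1,m}$ and $W_{2,m}$, such that for some $0<\xi<\frac12$, as $m\to\infty$, $$\sup_{k>m}\frac1{(k-m)^\xi}\Big\|\sum_{i=m+1}^k\{Y_i-\mathbb{E}Y_1\}-\Sigma^{1/2}W_{1,m}(k-m)\Big\|_2=O_{\mathbb P}(1)$$ and $$\frac1{m^\xi}\Big\|\sum_{i=1}^m\{Y_i-\mathbb{E}Y_1\}-\Sigma^{1/2}W_{2,m}(m)\Big\|_2=O_{\mathbb P}(1).$$ Assume moreover that $\Sigma_m\to\Sigma$ in probability as $m\to\infty$. Then, for every fixed $\eta>0$ and every $p$-dimensional standard Brownian motion $W$, the random variables (with values in $[0,\infty]$) $$\sup_{k>m}\Big(\frac mk\Big)^{3/2+\eta}D_m(k)$$ converge in distribution,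 as $m\to\infty$, to $$\mathcal L_{p,\eta}=\sup_{1\le s\le t<\infty}t^{-3/2-\eta}\,\|tW(s)-sW(t)\|_{I_p},$$ where the supremum on the left is over integers $k$, that on the right is over real $s,t$, and $I_p$ is the identity matrix. Moreover $\mathcal L_{p,\eta}<\infty$ almost surely. -/

import Mathlib

open MeasureTheory ProbabilityTheory Filter Topology
open scoped NNReal ENNReal Matrix

universe u v w

noncomputable section

namespace OpenEnd

/-! Time series are indexed by `ℕ` starting at `0`: the variable with index `i` is the
`(i+1)`-th observation, so that the observations number `j+1, …, k` are those with index in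
`Finset.Ico j k`. -/

/-- The weighted norm `‖y‖_M = √(yᵀ M y / p)` on `ℝ^p`. -/
def weightedNorm {p : ℕ} (M : Matrix (Fin p) (Fin p) ℝ) (y : EuclideanSpace ℝ (Fin p)) : ℝ :=
  Real.sqrt ((y.ofLp ⬝ᵥ (M *ᵥ y.ofLp)) / p)

/-- The vector of indicators `(1(X_i ≤ x_1), …, 1(X_i ≤ x_p))`, with componentwise order. -/
def indicatorSeries {Ω : Type*} {d p : ℕ} (X : ℕ → Ω → (Fin d → ℝ)) (x : Fin p → (Fin d → ℝ))
    (i : ℕ) (ω : Ω) : EuclideanSpace ℝ (Fin p) :=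
  WithLp.toLp 2 fun a => (Set.Iic (x a)).indicator (fun _ => (1 : ℝ)) (X i ω)

/-- Empirical distribution function at `z` of the observations number `j+1, …, k`
(zero if there are none). -/
def empCDF {Ω : Type*} {d : ℕ} (X : ℕ → Ω → (Fin d → ℝ)) (j k : ℕ) (z : Fin d → ℝ) (ω : Ω) : ℝ :=
  ((k : ℝ) - (j : ℝ))⁻¹ * ∑ i ∈ Finset.Ico j k, (Set.Iic z).indicator (fun _ => (1 : ℝ)) (X i ω)

/-- The empirical distribution function of the observations number `j+1, …, k` evaluated at the
points `x_1, …, x_p`. -/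
def empCDFVec {Ω : Type*} {d p : ℕ} (X : ℕ → Ω → (Fin d → ℝ)) (x : Fin p → (Fin d → ℝ))
    (j k : ℕ) (ω : Ω) : EuclideanSpace ℝ (Fin p) :=
  WithLp.toLp 2 fun a => empCDF X j k (x a) ω

/-- The value `Σ_m = S_m(Y_1, …, Y_m)` of an estimator based on the first `m` variables. -/
def estimate {Ω : Type*} {p : ℕ} (Y : ℕ → Ω → EuclideanSpace ℝ (Fin p))
    (S : (m : ℕ) → (Fin m → EuclideanSpace ℝ (Fin p)) → Matrix (Fin p) (Fin p) ℝ)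
    (m : ℕ) (ω : Ω) : Matrix (Fin p) (Fin p) ℝ :=
  S m fun i => Y i ω

/-- The detector
`D_m(k) = max_{m ≤ j < k} j (k - j) / m^{3/2} ‖F_{1:j} - F_{j+1:k}‖_{Σ_m⁻¹}`, for `k > m`. -/
def detector {Ω : Type*} {d p : ℕ} (X : ℕ → Ω → (Fin d → ℝ)) (x : Fin p → (Fin d → ℝ))
    (S : (m : ℕ) → (Fin m → EuclideanSpace ℝ (Fin p)) → Matrix (Fin p) (Fin p) ℝ)
    (m k : ℕ) (ω : Ω) : ℝ :=
  ⨆ j : Finset.Ico m k, ((j : ℕ) : ℝ) * ((k : ℝ) - ((j : ℕ) : ℝ)) / (m : ℝ) ^ (3 / 2 : ℝ) *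
    weightedNorm (estimate (indicatorSeries X x) S m ω)⁻¹
      (empCDFVec X x 0 j ω - empCDFVec X x j k ω)

/-- `sup_{k > m} (m/k)^{3/2+η} D_m(k)`, with values in `[0, ∞]`. -/
def scaledSupDetector {Ω : Type*} {d p : ℕ} (X : ℕ → Ω → (Fin d → ℝ)) (x : Fin p → (Fin d → ℝ))
    (S : (m : ℕ) → (Fin m → EuclideanSpace ℝ (Fin p)) → Matrix (Fin p) (Fin p) ℝ)
    (η : ℝ) (m : ℕ) (ω : Ω) : ℝ≥0∞ :=
  ⨆ (k : ℕ) (_ : m < k),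
    ENNReal.ofReal (((m : ℝ) / (k : ℝ)) ^ (3 / 2 + η) * detector X x S m k ω)

/-- `L_{p,η} = sup_{1 ≤ s ≤ t < ∞} t^{-3/2-η} ‖t W(s) - s W(t)‖_{I_p}`, with values
in `[0, ∞]`. -/
def limitVariable {Ω : Type*} {p : ℕ} (η : ℝ) (W : ℝ≥0 → Ω → EuclideanSpace ℝ (Fin p))
    (ω : Ω) : ℝ≥0∞ :=
  ⨆ (s : ℝ≥0) (t : ℝ≥0) (_ : 1 ≤ s) (_ : s ≤ t),
    ENNReal.ofReal ((t : ℝ) ^ (-(3 / 2) - η) *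
      weightedNorm (1 : Matrix (Fin p) (Fin p) ℝ) ((t : ℝ) • W s ω - (s : ℝ) • W t ω))

/-- A `p`-dimensional standard Brownian motion: its coordinates are independent real standard
Brownian motions. -/
structure IsStdBrownian {Ω : Type*} [MeasurableSpace Ω] {p : ℕ}
    (W : ℝ≥0 → Ω → EuclideanSpace ℝ (Fin p)) (P : Measure Ω) : Prop where
  coord : ∀ a : Fin p, IsBrownianReal (fun t ω => W t ω a) P
  indep : iIndepFun (fun (a : Fin p) (ω : Ω) (t : ℝ≥0) => W t ω a) P

/-- (Strict) stationarity: all shifts of the series have the law of the series. -/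
def IsStationary {Ω : Type*} [MeasurableSpace Ω] {p : ℕ}
    (Y : ℕ → Ω → EuclideanSpace ℝ (Fin p)) (P : Measure Ω) : Prop :=
  ∀ h : ℕ, IdentDistrib (fun ω i => Y (i + h) ω) (fun ω i => Y i ω) P P

/-- The matrix `Cov(Y_i, Y_j)`. -/
def crossCov {Ω : Type*} [MeasurableSpace Ω] {p : ℕ}
    (Y : ℕ → Ω → EuclideanSpace ℝ (Fin p)) (P : Measure Ω) (i j : ℕ) :
    Matrix (Fin p) (Fin p) ℝ :=
  Matrix.of fun a b => cov[fun ω => Y i ω a, fun ω => Y j ω b; P]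

/-- The long-run covariance matrix
`Cov(Y_1, Y_1) + ∑_{i ≥ 2} (Cov(Y_1, Y_i) + Cov(Y_i, Y_1))` exists and equals `Sig`. -/
def IsLongRunCov {Ω : Type*} [MeasurableSpace Ω] {p : ℕ}
    (Y : ℕ → Ω → EuclideanSpace ℝ (Fin p)) (P : Measure Ω)
    (Sig : Matrix (Fin p) (Fin p) ℝ) : Prop :=
  Tendsto (fun n : ℕ => crossCov Y P 0 0 +
    ∑ i ∈ Finset.range n, (crossCov Y P 0 (i + 1) + crossCov Y P (i + 1) 0)) atTop (𝓝 Sig)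

/-- `Z_m = O_P(1)` as `m → ∞`, for `[0, ∞]`-valued `Z_m`. -/
def IsBoundedInProbability {Ω : Type*} [MeasurableSpace Ω] (P : Measure Ω)
    (Z : ℕ → Ω → ℝ≥0∞) : Prop :=
  ∀ ε : ℝ≥0∞, 0 < ε → ∃ C : ℝ≥0, ∀ᶠ m in atTop, P {ω | (C : ℝ≥0∞) < Z m ω} ≤ ε

open scoped MatrixOrder Matrix.Norms.L2Operator in
/-- The unique positive semidefinite square root of a positive semidefinite matrix. -/
def matrixSqrt {p : ℕ} (A : Matrix (Fin p) (Fin p) ℝ) : Matrix (Fin p) (Fin p) ℝ :=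
  CFC.sqrt A

/-- The approximation error
`‖∑_{i=m+1}^{k} (Y_i - E Y_1) - A w‖₂`. -/
def approxError {Ω : Type*} [MeasurableSpace Ω] {p : ℕ}
    (Y : ℕ → Ω → EuclideanSpace ℝ (Fin p)) (P : Measure Ω) (A : Matrix (Fin p) (Fin p) ℝ)
    (m k : ℕ) (w : Ω → EuclideanSpace ℝ (Fin p)) (ω : Ω) : ℝ :=
  ‖∑ i ∈ Finset.Ico m k, (Y i ω - ∫ ω', Y 0 ω' ∂P) - WithLp.toLp 2 (A *ᵥ (w ω).ofLp)‖

/-- The strong approximation condition for the series `Y`, whose long-run covariance matrix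
is `Sig`: on some probability space there are a version `Y'` of the series (same law), which is
stationary with positive definite long-run covariance matrix `Sig`, and for each `m ≥ 1` two
independent standard Brownian motions `W₁ m`, `W₂ m`, such that the partial sums of `Y'` are
approximated at a polynomial rate with exponent `ξ < 1/2`. -/
def StrongApproximation {Ω : Type u} [MeasurableSpace Ω] {p : ℕ}
    (Y : ℕ → Ω → EuclideanSpace ℝ (Fin p)) (P : Measure Ω)
    (Sig : Matrix (Fin p) (Fin p) ℝ) : Prop :=
  ∃ (Ω' : Type w) (_ : MeasurableSpace Ω') (P' : Measure Ω') (_ : IsProbabilityMeasure P')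
    (Y' : ℕ → Ω' → EuclideanSpace ℝ (Fin p))
    (W₁ W₂ : ℕ → ℝ≥0 → Ω' → EuclideanSpace ℝ (Fin p)),
    IdentDistrib (fun ω i => Y' i ω) (fun ω i => Y i ω) P' P ∧
    IsStationary Y' P' ∧
    IsLongRunCov Y' P' Sig ∧
    Sig.PosDef ∧
    (∀ m : ℕ, 1 ≤ m → IsStdBrownian (W₁ m) P' ∧ IsStdBrownian (W₂ m) P' ∧
      IndepFun (fun ω t => W₁ m t ω) (fun ω t => W₂ m t ω) P') ∧
    ∃ ξ : ℝ, 0 < ξ ∧ ξ < 1 / 2 ∧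
      IsBoundedInProbability P' (fun m ω => ⨆ (k : ℕ) (_ : m < k),
        ENNReal.ofReal (1 / ((k : ℝ) - (m : ℝ)) ^ ξ *
          approxError Y' P' (matrixSqrt Sig) m k (W₁ m ((k - m : ℕ) : ℝ≥0)) ω)) ∧
      IsBoundedInProbability P' (fun m ω =>
        ENNReal.ofReal (1 / (m : ℝ) ^ ξ *
          approxError Y' P' (matrixSqrt Sig) 0 m (W₂ m (m : ℝ≥0)) ω))

end OpenEnd

end

/-! Clearing denominators gives j(k-j)(F_{1:j} - F_{j+1:k}) = k S_j - j S_k with S the partial sums,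
so the statistic is a weighted supremum of a tied-down path (`scaledSupDetector_eq_tiedDownSup`).
Tying down annihilates linear drift, so the mean plays no role. For k ≥ m the strong approximation
replaces S_k, up to drift, by Σ^{1/2}(W₂(m) + W₁(k-m)) with error O_P(k^ξ); as ξ < 1/2, the weights
turn this into O_P(m^{ξ-1/2}) uniformly in j and k (`norm_weight_smul_tiedDown_le`). The root
Σ^{1/2} cancels Σ⁻¹ in the norm, and replacing Σ by Σ_m costs little while the Gaussian supremum
stays bounded, which tightness ensures with high probability (`exists_tiedDownSup_close`,
`tendsto_measure_not_close`).

It remains to treat the glued Gaussian path. For fixed m it has, at integers j ≥ m, the law of √m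
W(j/m) for one Brownian motion W (`identDistrib_glued_brownian`). Its functional is then the
supremum in L_{p,η} restricted to a grid of mesh 1/m, and continuity of paths gives almost sure
convergence (`tendsto_tiedDownSup_scaled`). The limit is finite because W(t) = O(t^{1/2+η}), by
Doob's inequality at dyadic times and Borel–Cantelli (`ae_exists_abs_le_rpow`); this also yields the
tightness.

The comparison takes place on the space of the approximation. Returning to the X_i requires the
statistic to be a measurable function of the series: `S` is arbitrary, but it only sees finitely
many patterns of zeros and ones (`measurable_comp_roundedEstimator`). -/

namespace OpenEnd

/-! ### Maximal inequality and growth of Brownian motion. -/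

section Brownian

variable {Ω : Type*} [MeasurableSpace Ω] {P : Measure Ω}

/-- Doob's maximal inequality for a pre-Brownian motion along a regular grid, measurable case. -/
theorem mul_measure_exists_grid_le_of_measurable {B : ℝ≥0 → Ω → ℝ} (hB : IsPreBrownianReal B P)
    (hm : ∀ t, Measurable (B t)) (δ l : ℝ≥0) (n : ℕ) :
    (l : ℝ≥0∞) * P {ω | ∃ k ≤ n, (l : ℝ) ≤ |B (k * δ) ω|} ≤
      ENNReal.ofReal (∫ ω, |B (n * δ) ω| ∂P) := by
  have hP : IsProbabilityMeasure P := hB.isGaussianProcess.isProbabilityMeasure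
  let f : ℕ → Ω → ℝ := fun k => B (k * δ)
  have hf : ∀ k, StronglyMeasurable (f k) := fun k => (hm _).stronglyMeasurable
  have hint : ∀ k, Integrable (f k) P := fun k => hB.integrable_eval _
  let G := Filtration.natural f hf
  -- The natural filtration of the grid values lies in the past of `B` up to time `k * δ`, of which
  -- the next increment is independent; centred increments then give the martingale property.
  have hmart : Martingale f G P := by
    refine martingale_of_condExp_sub_eq_zero_nat (Filtration.stronglyAdapted_natural hf) hint
      fun k => ?_
    have hind := hB.indepFun_shift ((k : ℝ≥0) * δ)
    have hind' : IndepFun (f (k + 1) - f k) (fun ω (t : Set.Iic ((k : ℝ≥0) * δ)) => B t ω) P := by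
      have hφ : Measurable fun x : ℝ≥0 → ℝ => x δ := measurable_pi_apply δ
      have h1 := hind.comp (φ := fun x : ℝ≥0 → ℝ => x δ) (ψ := id) hφ
        measurable_id
      have h2 : (f (k + 1) - f k) = (fun x : ℝ≥0 → ℝ => x δ) ∘
          (fun ω t => B ((k : ℝ≥0) * δ + t) ω - B ((k : ℝ≥0) * δ) ω) := by
        ext ω
        simp [f, add_mul]
      rw [h2]
      exact h1
    have hle : (G k : MeasurableSpace Ω) ≤
        MeasurableSpace.comap (fun ω (t : Set.Iic ((k : ℝ≥0) * δ)) => B t ω) inferInstance := by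
      change (⨆ j ≤ k, MeasurableSpace.comap (f j) _) ≤ _
      refine iSup₂_le fun j hj => ?_
      have hjk : (j : ℝ≥0) * δ ≤ k * δ := by gcongr
      have h3 : f j = (fun x : Set.Iic ((k : ℝ≥0) * δ) → ℝ => x ⟨(j : ℝ≥0) * δ, hjk⟩) ∘
          (fun ω (t : Set.Iic ((k : ℝ≥0) * δ)) => B t ω) := rfl
      rw [h3, ← MeasurableSpace.comap_comp]
      exact MeasurableSpace.comap_mono (measurable_pi_apply _).comap_le
    have hI : Indep (MeasurableSpace.comap (f (k + 1) - f k) inferInstance) (G k) P :=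
      indep_of_indep_of_le_right hind' hle
    have h4 := condExp_indep_eq (((hm _).sub (hm _)).comap_le) (G.le k)
      (comap_measurable (f (k + 1) - f k)).stronglyMeasurable hI
    refine h4.trans (Eventually.of_forall fun _ => ?_)
    have h5 : P[f (k + 1) - f k] = P[f (k + 1)] - P[f k] := by
      exact integral_sub (hint _) (hint _)
    simp only [Pi.zero_apply]
    rw [h5, hB.integral_eval, hB.integral_eval, sub_zero]
  have hsub : Submartingale (f ⊔ -f) G P := hmart.submartingale.sup hmart.neg.submartingale
  have hval : ∀ k ω, (f ⊔ -f) k ω = |f k ω| := fun k ω => rfl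
  have hmax := maximal_ineq hsub (fun k ω => by rw [hval]; exact abs_nonneg _) (ε := l) n
  have hset : {ω | ∃ k ≤ n, (l : ℝ) ≤ |B (k * δ) ω|} =
      {ω | (l : ℝ) ≤ (Finset.range (n + 1)).sup' Finset.nonempty_range_add_one
        fun k => (f ⊔ -f) k ω} := by
    ext ω
    simp [Finset.le_sup'_iff, hval, f]
  rw [hset]
  refine hmax.trans (ENNReal.ofReal_le_ofReal ?_)
  refine setIntegral_le_integral ?_ (Eventually.of_forall fun ω => abs_nonneg _)
  exact (hint n).abs

theorem mul_measure_exists_grid_le {B : ℝ≥0 → Ω → ℝ} (hB : IsPreBrownianReal B P)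
    (δ l : ℝ≥0) (n : ℕ) :
    (l : ℝ≥0∞) * P {ω | ∃ k ≤ n, (l : ℝ) ≤ |B (k * δ) ω|} ≤
      ENNReal.ofReal √(n * δ) := by
  have hP : IsProbabilityMeasure P := hB.isGaussianProcess.isProbabilityMeasure
  -- Only countably many times enter the event, so passing to a measurable version changes it by a
  -- null set.
  let B' : ℝ≥0 → Ω → ℝ := fun t => (hB.aemeasurable t).mk
  have hBB' : ∀ t, B t =ᵐ[P] B' t := fun t => (hB.aemeasurable t).ae_eq_mk
  have hB' : IsPreBrownianReal B' P := hB.congr hBB'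
  have h := mul_measure_exists_grid_le_of_measurable hB'
    (fun t => (hB.aemeasurable t).measurable_mk) δ l n
  have hset : P {ω | ∃ k ≤ n, (l : ℝ) ≤ |B (k * δ) ω|} =
      P {ω | ∃ k ≤ n, (l : ℝ) ≤ |B' (k * δ) ω|} := by
    refine measure_congr ?_
    have : ∀ᵐ ω ∂P, ∀ k : ℕ, B (k * δ) ω = B' (k * δ) ω := ae_all_iff.2 fun k => hBB' _
    filter_upwards [this] with ω hω
    simp only [eq_iff_iff]
    change (∃ k ≤ n, (l : ℝ) ≤ |B (k * δ) ω|) ↔ (∃ k ≤ n, (l : ℝ) ≤ |B' (k * δ) ω|)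
    simp_rw [hω]
  rw [hset]
  refine h.trans (ENNReal.ofReal_le_ofReal ?_)
  refine Real.le_sqrt_of_sq_le ?_
  have hlaw := hB'.hasLaw_eval ((n : ℝ≥0) * δ)
  have hL2 : MemLp (B' (n * δ)) 2 P := (hB'.isGaussianProcess.hasGaussianLaw_eval _).memLp_two
  have hv : Var[B' (n * δ); P] = n * δ := by
    rw [hlaw.variance_eq, variance_id_gaussianReal]
    simp
  have hv2 := variance_eq_sub hL2
  rw [hB'.integral_eval, hv] at hv2
  have hL2' : MemLp (fun ω => |B' (n * δ) ω|) 2 P := hL2.abs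
  have hv3 := variance_eq_sub hL2'
  -- Nonnegativity of this variance is the bound (E|B|)² ≤ E B², where E B² = nδ.
  have hv4 := variance_nonneg (fun ω => |B' (n * δ) ω|) P
  have h6 : P[(fun ω => |B' (n * δ) ω|) ^ 2] = P[(B' (n * δ)) ^ 2] := by
    congr 1
    ext ω
    simp
  rw [hv3, h6] at hv4
  simp only [ne_eq, OfNat.ofNat_ne_zero, not_false_eq_true, zero_pow, sub_zero] at hv2
  rw [← hv2] at hv4
  linarith

/-- Doob's maximal inequality for Brownian motion. -/
theorem mul_measure_exists_le_le {B : ℝ≥0 → Ω → ℝ} (hB : IsBrownianReal B P) (T l : ℝ≥0) :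
    (l : ℝ≥0∞) * P {ω | ∃ t ≤ T, (l : ℝ) < |B t ω|} ≤ ENNReal.ofReal √T := by
  -- Dyadic grids are nested, so these events increase. By continuity a strict exceedance at `t`
  -- persists at a nearby grid point, which is why the target event has `<`.
  let A : ℕ → Set Ω := fun N => {ω | ∃ k ≤ 2 ^ N, (l : ℝ) ≤ |B ((k : ℕ) * (T / 2 ^ N)) ω|}
  have hA : ∀ N, (l : ℝ≥0∞) * P (A N) ≤ ENNReal.ofReal √T := fun N => by
    have h := mul_measure_exists_grid_le hB.toIsPreBrownianReal (T / 2 ^ N) l (2 ^ N)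
    have h2 : ((2 ^ N : ℕ) : ℝ) * ((T / 2 ^ N : ℝ≥0) : ℝ) = T := by
      push_cast
      field_simp
    rwa [h2] at h
  have hmono : Monotone A := by
    refine monotone_nat_of_le_succ fun N ω => ?_
    rintro ⟨k, hk, h⟩
    refine ⟨2 * k, by rw [pow_succ]; omega, ?_⟩
    have : ((2 * k : ℕ) : ℝ≥0) * (T / 2 ^ (N + 1)) = k * (T / 2 ^ N) := by
      push_cast
      rw [pow_succ]
      field_simp
    rwa [this]
  have hsub : P {ω | ∃ t ≤ T, (l : ℝ) < |B t ω|} ≤ P (⋃ N, A N) := by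
    refine measure_mono_ae ?_
    filter_upwards [hB.cont] with ω hω
    rintro ⟨t, htT, ht⟩
    change ω ∈ ⋃ N, A N
    have hT : T = 0 ∨ 0 < T := eq_or_ne T 0 |>.imp id pos_of_ne_zero
    rcases hT with rfl | hT
    · obtain rfl : t = 0 := le_antisymm htT zero_le
      exact Set.mem_iUnion.2 ⟨0, 0, by simp, by simpa using ht.le⟩
    have hlim : Tendsto (fun N : ℕ => (⌊(t / T) * 2 ^ N⌋₊ : ℝ≥0) * (T / 2 ^ N)) atTop (𝓝 t) := by
      have h1 : Tendsto (fun N : ℕ => (⌊(t / T) * 2 ^ N⌋₊ : ℝ≥0) / 2 ^ N) atTop (𝓝 (t / T)) := by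
        rw [← NNReal.tendsto_coe]
        have h0 := (tendsto_nat_floor_mul_div_atTop (R := ℝ) (t / T).2).comp
          (tendsto_pow_atTop_atTop_of_one_lt (one_lt_two : (1 : ℝ) < 2))
        refine h0.congr fun N => ?_
        simp only [Function.comp_apply, NNReal.coe_div, NNReal.coe_natCast, NNReal.coe_pow,
          NNReal.coe_ofNat]
        congr 2
      have h2 := h1.mul_const T
      rw [div_mul_cancel₀ _ hT.ne'] at h2
      refine h2.congr fun N => ?_
      rw [div_mul_eq_mul_div, mul_div_assoc]
    have hev := ((hω.abs.tendsto t).comp hlim).eventually (lt_mem_nhds ht)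
    obtain ⟨N, hN⟩ := hev.exists
    refine Set.mem_iUnion.2 ⟨N, ⌊(t / T) * 2 ^ N⌋₊, ?_, hN.le⟩
    refine Nat.floor_le_of_le ?_
    push_cast
    calc t / T * 2 ^ N ≤ 1 * 2 ^ N := by
          gcongr
          exact div_le_one_of_le₀ htT zero_le
      _ = 2 ^ N := one_mul _
  calc (l : ℝ≥0∞) * P {ω | ∃ t ≤ T, (l : ℝ) < |B t ω|} ≤ l * P (⋃ N, A N) := by gcongr
    _ = ⨆ N, (l : ℝ≥0∞) * P (A N) := by
        rw [hmono.measure_iUnion, ENNReal.mul_iSup]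
    _ ≤ _ := iSup_le hA

/-- Brownian motion grows more slowly than `t ^ (1 / 2 + η)`. -/
theorem ae_exists_abs_le_rpow {B : ℝ≥0 → Ω → ℝ} (hB : IsBrownianReal B P) {η : ℝ} (hη : 0 < η) :
    ∀ᵐ ω ∂P, ∃ C : ℝ, ∀ t : ℝ≥0, 1 ≤ t → |B t ω| ≤ C * (t : ℝ) ^ (1 / 2 + η) := by
  -- Doob's bound at time 2^n and level (2^n)^{1/2+η} is the ratio 2^{-ηn}, which is summable.
  let A : ℕ → Set Ω := fun n =>
    {ω | ∃ t ≤ (2 : ℝ≥0) ^ n, ((((2 : ℝ≥0) ^ n) ^ (1 / 2 + η) : ℝ≥0) : ℝ) < |B t ω|}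
  have hA : ∀ n, P (A n) ≤ (((2 : ℝ≥0) ^ (-η) : ℝ≥0) : ℝ≥0∞) ^ n := fun n => by
    have h := mul_measure_exists_le_le hB (2 ^ n) (((2 : ℝ≥0) ^ n) ^ (1 / 2 + η))
    have hx : (0 : ℝ≥0) < 2 ^ n := by positivity
    have h1 : ENNReal.ofReal √((2 ^ n : ℝ≥0) : ℝ) =
        ((((2 : ℝ≥0) ^ n) ^ (1 / 2 + η) : ℝ≥0) : ℝ≥0∞) *
          ((((2 : ℝ≥0) ^ (-η)) ^ n : ℝ≥0) : ℝ≥0∞) := by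
      rw [← ENNReal.coe_mul, ← Real.coe_sqrt, ENNReal.ofReal_coe_nnreal]
      congr 1
      rw [← NNReal.rpow_natCast ((2 : ℝ≥0) ^ (-η)), ← NNReal.rpow_mul, mul_comm (-η),
        NNReal.rpow_mul, NNReal.rpow_natCast, ← NNReal.rpow_add hx.ne', NNReal.sqrt_eq_rpow]
      congr 1
      ring
    rw [h1] at h
    rw [ENNReal.mul_le_mul_iff_right (by simp) ENNReal.coe_ne_top] at h
    rw [← ENNReal.coe_pow]
    exact h
  have hr : (((2 : ℝ≥0) ^ (-η) : ℝ≥0) : ℝ≥0∞) < 1 := by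
    rw [ENNReal.coe_lt_one_iff]
    exact NNReal.rpow_lt_one_of_one_lt_of_neg one_lt_two (by linarith)
  have hsum : ∑' n, P (A n) ≠ ∞ := by
    refine ne_top_of_le_ne_top ?_ (ENNReal.tsum_le_tsum hA)
    rw [ENNReal.tsum_geometric]
    exact ENNReal.inv_ne_top.2 (tsub_pos_of_lt hr).ne'
  filter_upwards [ae_eventually_notMem hsum] with ω hω
  obtain ⟨N, hN⟩ := eventually_atTop.1 hω
  -- If 2^n ≤ t < 2^{n+1}, the event with index N+n+1 ≥ N applies, and 2^{N+n+1} ≤ 2^{N+1} t.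
  refine ⟨((2 : ℝ) ^ (N + 1)) ^ (1 / 2 + η), fun t ht => ?_⟩
  obtain ⟨n, hn1, hn2⟩ := exists_nat_pow_near (x := t) (y := (2 : ℝ≥0)) ht one_lt_two
  have h1 := hN (N + (n + 1)) (by omega)
  simp only [A, Set.mem_ofPred_eq, not_exists, not_and, not_lt] at h1
  have h2 : (2 : ℝ≥0) ^ (n + 1) ≤ 2 ^ (N + (n + 1)) :=
    pow_le_pow_right₀ one_le_two (by omega)
  refine (h1 t (hn2.le.trans h2)).trans ?_
  rw [← Real.mul_rpow (by positivity) (by positivity), NNReal.coe_rpow]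
  refine Real.rpow_le_rpow (by positivity) ?_ (by linarith)
  have h3 : ((2 : ℝ≥0) ^ n : ℝ) ≤ t := by exact_mod_cast hn1
  push_cast at h3 ⊢
  calc (2 : ℝ) ^ (N + (n + 1)) = 2 ^ (N + 1) * 2 ^ n := by ring
    _ ≤ _ := by gcongr

end Brownian

end OpenEnd

/-! ### Equality in law of glued and rescaled Brownian motions. -/

namespace OpenEnd

/-- If the pairs `(U a, V a)` are independent, and each of them has independent components, then
the families `U` and `V` are independent. -/
theorem indepFun_pi_of_iIndepFun_prodMk {Ω ι α β : Type*} [MeasurableSpace Ω] [Fintype ι]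
    [MeasurableSpace α] [MeasurableSpace β] {P : Measure Ω} [IsProbabilityMeasure P]
    {U : ι → Ω → α} {V : ι → Ω → β} (hU : ∀ a, AEMeasurable (U a) P)
    (hV : ∀ a, AEMeasurable (V a) P) (h : iIndepFun (fun a ω => (U a ω, V a ω)) P)
    (hUV : ∀ a, IndepFun (U a) (V a) P) :
    IndepFun (fun ω a => U a ω) (fun ω a => V a ω) P := by
  have hprobU : ∀ a, IsProbabilityMeasure (P.map (U a)) :=
    fun a => Measure.isProbabilityMeasure_map (hU a)
  have hprobV : ∀ a, IsProbabilityMeasure (P.map (V a)) :=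
    fun a => Measure.isProbabilityMeasure_map (hV a)
  have hUi : iIndepFun U P := h.comp (fun _ => Prod.fst) fun _ => measurable_fst
  have hVi : iIndepFun V P := h.comp (fun _ => Prod.snd) fun _ => measurable_snd
  rw [indepFun_iff_map_prod_eq_prod_map_map (aemeasurable_pi_lambda _ hU)
    (aemeasurable_pi_lambda _ hV), (iIndepFun_iff_map_fun_eq_pi_map hU).1 hUi,
    (iIndepFun_iff_map_fun_eq_pi_map hV).1 hVi]
  have hpair := (iIndepFun_iff_map_fun_eq_pi_map fun a => (hU a).prodMk (hV a)).1 h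
  have hpair' : P.map (fun ω a => (U a ω, V a ω)) =
      Measure.pi fun a => (P.map (U a)).prod (P.map (V a)) := by
    rw [hpair]
    congr 1
    ext1 a
    exact (indepFun_iff_map_prod_eq_prod_map_map (hU a) (hV a)).1 (hUV a)
  rw [← (measurePreserving_arrowProdEquivProdArrow α β ι (fun a => P.map (U a))
    (fun a => P.map (V a))).map_eq, ← hpair', AEMeasurable.map_map_of_aemeasurable
    (MeasurableEquiv.measurable _).aemeasurable
    (aemeasurable_pi_lambda _ fun a => (hU a).prodMk (hV a))]
  rfl

section Law

variable {Ω : Type*} [MeasurableSpace Ω] {P : Measure Ω}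
  {Ω' : Type*} [MeasurableSpace Ω'] {P' : Measure Ω'}

/-- Both laws are projective limits of the same Gaussian family. The values `B t` are only a.e.
measurable, and a countable set of times keeps the whole path a.e. measurable. -/
theorem identDistrib_natCast_of_isPreBrownianReal {B : ℝ≥0 → Ω → ℝ} {B' : ℝ≥0 → Ω' → ℝ}
    (hB : IsPreBrownianReal B P) (hB' : IsPreBrownianReal B' P') :
    IdentDistrib (fun ω (n : ℕ) => B n ω) (fun ω (n : ℕ) => B' n ω) P P' := by
  have hP : IsProbabilityMeasure P := hB.isGaussianProcess.isProbabilityMeasure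
  have hm : AEMeasurable (fun ω (n : ℕ) => B n ω) P :=
    aemeasurable_pi_lambda _ fun n => hB.aemeasurable n
  have hm' : AEMeasurable (fun ω (n : ℕ) => B' n ω) P' :=
    aemeasurable_pi_lambda _ fun n => hB'.aemeasurable n
  refine ⟨hm, hm', ?_⟩
  have h1 := isProjectiveLimit_map (X := fun (n : ℕ) ω => B n ω) hm
  have h2 := isProjectiveLimit_map (X := fun (n : ℕ) ω => B' n ω) hm'
  have key : (fun I : Finset ℕ => P.map (fun ω => I.restrict fun n => B n ω)) =
      fun I : Finset ℕ => P'.map (fun ω => I.restrict fun n => B' n ω) := by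
    ext1 I
    let J : Finset ℝ≥0 := I.image fun n : ℕ => (n : ℝ≥0)
    let g : (J → ℝ) → (I → ℝ) := fun x n => x ⟨(n : ℕ), Finset.mem_image_of_mem _ n.2⟩
    have hg : Measurable g := measurable_pi_lambda _ fun n => measurable_pi_apply _
    have e1 := (hB.hasLaw J).map_eq
    rw [← (hB'.hasLaw J).map_eq] at e1
    have e2 := congrArg (Measure.map g) e1
    rwa [AEMeasurable.map_map_of_aemeasurable hg.aemeasurable (hB.hasLaw J).aemeasurable,
      AEMeasurable.map_map_of_aemeasurable hg.aemeasurable (hB'.hasLaw J).aemeasurable] at e2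
  rw [key] at h1
  have : ∀ I : Finset ℕ, IsFiniteMeasure (P'.map (fun ω => I.restrict fun n => B' n ω)) := by
    intro I
    have := hB'.isGaussianProcess.isProbabilityMeasure
    infer_instance
  exact h1.unique h2

theorem identDistrib_eval_of_isPreBrownianReal {B : ℝ≥0 → Ω → ℝ} {B' : ℝ≥0 → Ω' → ℝ}
    (hB : IsPreBrownianReal B P) (hB' : IsPreBrownianReal B' P') (t : ℝ≥0) :
    IdentDistrib (B t) (B' t) P P' :=
  ⟨hB.aemeasurable t, hB'.aemeasurable t,
    (hB.hasLaw_eval t).map_eq.trans (hB'.hasLaw_eval t).map_eq.symm⟩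

/-- Two independent Brownian motions can be glued at time `m`: the value of one at time `m` and
the values of the other at integer times are jointly distributed as the value at `1` and the
increments after `1`, suitably rescaled, of a single Brownian motion. -/
theorem identDistrib_glued_brownian [IsProbabilityMeasure P] [IsProbabilityMeasure P'] {p : ℕ}
    {W₁ W₂ : ℝ≥0 → Ω → EuclideanSpace ℝ (Fin p)} {W : ℝ≥0 → Ω' → EuclideanSpace ℝ (Fin p)}
    (h₁ : IsStdBrownian W₁ P) (h₂ : IsStdBrownian W₂ P)
    (h₁₂ : IndepFun (fun ω t => W₁ t ω) (fun ω t => W₂ t ω) P) (h : IsStdBrownian W P')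
    {m : ℕ} (hm : 1 ≤ m) :
    IdentDistrib
      (fun ω => ((fun a (n : ℕ) => W₁ n ω a : Fin p → ℕ → ℝ), (fun a => W₂ m ω a : Fin p → ℝ)))
      (fun ω => ((fun a (n : ℕ) => √m * (W (1 + n / m) ω a - W 1 ω a) : Fin p → ℕ → ℝ),
        (fun a => √m * W 1 ω a : Fin p → ℝ))) P P' := by
  have hm0 : (m : ℝ≥0) ≠ 0 := by positivity
  have hc : ((m : ℝ≥0)⁻¹) ≠ 0 := inv_ne_zero hm0
  have hsqrt : (√(((m : ℝ≥0)⁻¹ : ℝ≥0) : ℝ))⁻¹ = √m := by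
    rw [NNReal.coe_inv, Real.sqrt_inv, inv_inv, NNReal.coe_natCast]
  have hshift : ∀ a, IsPreBrownianReal
      (fun t ω => √m * (W (1 + t / m) ω a - W 1 ω a)) P' := fun a => by
    have := ((h.coord a).toIsPreBrownianReal.shift 1).smul hc
    rw [hsqrt] at this
    simpa only [inv_mul_eq_div] using this
  have hscale : ∀ a, IsPreBrownianReal (fun t ω => √m * W (t / m) ω a) P' := fun a => by
    have := (h.coord a).toIsPreBrownianReal.smul hc
    rw [hsqrt] at this
    simpa only [inv_mul_eq_div] using this
  have e1 : ∀ a, IdentDistrib (fun ω (n : ℕ) => W₁ n ω a)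
      (fun ω (n : ℕ) => √m * (W (1 + n / m) ω a - W 1 ω a)) P P' := fun a =>
    identDistrib_natCast_of_isPreBrownianReal (h₁.coord a).toIsPreBrownianReal (hshift a)
  have e2 : ∀ a, IdentDistrib (fun ω => W₂ m ω a) (fun ω => √m * W 1 ω a) P P' := fun a => by
    have := identDistrib_eval_of_isPreBrownianReal (h₂.coord a).toIsPreBrownianReal (hscale a) m
    simpa only [div_self hm0] using this
  have i1 : iIndepFun (fun a ω (n : ℕ) => W₁ n ω a) P :=
    h₁.indep.comp (fun _ x (n : ℕ) => x n)
      fun _ => measurable_pi_lambda _ fun n => measurable_pi_apply _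
  have i2 : iIndepFun (fun a ω => W₂ m ω a) P :=
    h₂.indep.comp (fun _ x => x m) fun _ => measurable_pi_apply _
  have i12 : IndepFun (fun ω a (n : ℕ) => W₁ n ω a) (fun ω a => W₂ m ω a) P := by
    refine h₁₂.comp
      (φ := fun (x : ℝ≥0 → EuclideanSpace ℝ (Fin p)) (a : Fin p) (n : ℕ) => x n a)
      (ψ := fun (x : ℝ≥0 → EuclideanSpace ℝ (Fin p)) (a : Fin p) => x m a) ?_ ?_ <;> fun_prop
  -- Across coordinates, each pair is a function of its own coordinate path; within a coordinate
  -- (`icomp`), increments after time 1 are independent of the past up to time 1.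
  have ipair : iIndepFun (fun a ω =>
      ((fun n : ℕ => √m * (W (1 + n / m) ω a - W 1 ω a)), √m * W 1 ω a)) P' := by
    refine h.indep.comp (fun _ x => ((fun n : ℕ => √m * (x (1 + n / m) - x 1)), √m * x 1))
      fun _ => ?_
    fun_prop
  have icomp : ∀ a, IndepFun (fun ω (n : ℕ) => √m * (W (1 + n / m) ω a - W 1 ω a))
      (fun ω => √m * W 1 ω a) P' := fun a => by
    have := (h.coord a).toIsPreBrownianReal.indepFun_shift 1
    refine this.comp (φ := fun x (n : ℕ) => √m * x (n / m))
      (ψ := fun x : Set.Iic (1 : ℝ≥0) → ℝ => √m * x ⟨1, Set.mem_Iic.2 le_rfl⟩) ?_ ?_ <;> fun_prop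
  have i12' := indepFun_pi_of_iIndepFun_prodMk (fun a => (e1 a).aemeasurable_snd)
    (fun a => (e2 a).aemeasurable_snd) ipair icomp
  have i1' : iIndepFun (fun a ω (n : ℕ) => √m * (W (1 + n / m) ω a - W 1 ω a)) P' :=
    ipair.comp (fun _ => Prod.fst) fun _ => measurable_fst
  have i2' : iIndepFun (fun a ω => √m * W 1 ω a) P' :=
    ipair.comp (fun _ => Prod.snd) fun _ => measurable_snd
  exact (IdentDistrib.pi e1 i1 i1').prodMk (IdentDistrib.pi e2 i2 i2') i12 i12'

end Law

end OpenEnd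

namespace OpenEnd

variable {p : ℕ}

/-! ### The weighted norm -/

theorem weightedNorm_nonneg (M : Matrix (Fin p) (Fin p) ℝ) (y : EuclideanSpace ℝ (Fin p)) :
    0 ≤ weightedNorm M y :=
  Real.sqrt_nonneg _

theorem weightedNorm_smul (M : Matrix (Fin p) (Fin p) ℝ) {c : ℝ} (hc : 0 ≤ c)
    (y : EuclideanSpace ℝ (Fin p)) : weightedNorm M (c • y) = c * weightedNorm M y := by
  unfold weightedNorm
  rw [WithLp.ofLp_smul, Matrix.mulVec_smul, smul_dotProduct, dotProduct_smul, smul_eq_mul,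
    smul_eq_mul, ← mul_assoc, mul_div_assoc, Real.sqrt_mul (mul_self_nonneg c),
    Real.sqrt_mul_self hc]

theorem weightedNorm_one (y : EuclideanSpace ℝ (Fin p)) :
    weightedNorm 1 y = ‖y‖ / √p := by
  unfold weightedNorm
  rw [Matrix.one_mulVec, EuclideanSpace.norm_eq, ← Real.sqrt_div' _ (Nat.cast_nonneg p)]
  simp [dotProduct, sq]

theorem norm_eq_sqrt_mul_weightedNorm_one (y : EuclideanSpace ℝ (Fin p)) :
    ‖y‖ = √p * weightedNorm 1 y := by
  rcases Nat.eq_zero_or_pos p with rfl | hp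
  · have : y = 0 := Subsingleton.elim _ _
    simp [this]
  · rw [weightedNorm_one]
    have : (0 : ℝ) < √p := by positivity
    field_simp

theorem measurable_weightedNorm {Ω : Type*} [MeasurableSpace Ω]
    {M : Ω → Matrix (Fin p) (Fin p) ℝ} {y : Ω → EuclideanSpace ℝ (Fin p)}
    (hM : ∀ a b, Measurable fun ω => M ω a b) (hy : Measurable y) :
    Measurable fun ω => weightedNorm (M ω) (y ω) := by
  unfold weightedNorm
  simp only [dotProduct, Matrix.mulVec]
  have : ∀ a, Measurable fun ω => (y ω).ofLp a := fun a => by fun_prop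
  fun_prop

/-- The weighted norm depends continuously on the vector and on the inverse of the weight. -/
theorem continuousAt_weightedNorm_inv {Sig : Matrix (Fin p) (Fin p) ℝ} (hSig : Sig.PosDef)
    (y : EuclideanSpace ℝ (Fin p)) :
    ContinuousAt (fun q : (Fin p → Fin p → ℝ) × EuclideanSpace ℝ (Fin p) =>
      weightedNorm (Matrix.of q.1)⁻¹ q.2) (Sig, y) := by
  have hdet : Sig.det ≠ 0 := hSig.det_pos.ne'
  have hinv : ContinuousAt (fun M : Matrix (Fin p) (Fin p) ℝ => M⁻¹) Sig := by
    refine continuousAt_matrix_inv _ ?_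
    rw [Ring.inverse_eq_inv']
    exact continuousAt_inv₀ hdet
  have h1 : ContinuousAt (fun q : (Fin p → Fin p → ℝ) × EuclideanSpace ℝ (Fin p) =>
      ((Matrix.of q.1)⁻¹ : Matrix (Fin p) (Fin p) ℝ)) (Sig, y) := by
    exact ContinuousAt.comp (f := fun q : (Fin p → Fin p → ℝ) × EuclideanSpace ℝ (Fin p) =>
      (Matrix.of q.1 : Matrix (Fin p) (Fin p) ℝ)) hinv continuous_fst.continuousAt
  have h2 : ContinuousAt (fun q : (Fin p → Fin p → ℝ) × EuclideanSpace ℝ (Fin p) =>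
      q.2.ofLp) (Sig, y) := by
    exact ((PiLp.continuous_ofLp 2 _).comp continuous_snd).continuousAt
  have h3 : Continuous fun q : Matrix (Fin p) (Fin p) ℝ × (Fin p → ℝ) =>
      Real.sqrt ((q.2 ⬝ᵥ (q.1 *ᵥ q.2)) / p) := by
    refine Real.continuous_sqrt.comp (Continuous.div_const ?_ _)
    exact continuous_snd.dotProduct (continuous_fst.matrix_mulVec continuous_snd)
  exact ContinuousAt.comp (f := fun q : (Fin p → Fin p → ℝ) × EuclideanSpace ℝ (Fin p) =>
    (((Matrix.of q.1)⁻¹ : Matrix (Fin p) (Fin p) ℝ), q.2.ofLp)) h3.continuousAt (h1.prodMk h2)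

/-- The weighted norm depends continuously on the vector and on the inverse of the weight,
uniformly for vectors in a compact set. -/
theorem exists_weightedNorm_inv_close {Sig : Matrix (Fin p) (Fin p) ℝ} (hSig : Sig.PosDef)
    {K : Set (EuclideanSpace ℝ (Fin p))} (hK : IsCompact K) {δ : ℝ} (hδ : 0 < δ) :
    ∃ ε > 0, ∀ N : Matrix (Fin p) (Fin p) ℝ, (∀ a c, |N a c - Sig a c| < ε) →
      ∀ v ∈ K, ∀ u, ‖u - v‖ < ε → |weightedNorm Sig⁻¹ v - weightedNorm N⁻¹ u| < δ := by
  let s : Fin p → Fin p → ℝ := Sig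
  -- Continuity is known only at the points of `{Sig} × K`, as inversion may fail to be continuous
  -- at singular matrices. Compactness of this set still gives one radius for all its points.
  have huc := ((isCompact_singleton (x := s)).prod hK).uniformContinuousAt_of_continuousAt
    (fun q : (Fin p → Fin p → ℝ) × EuclideanSpace ℝ (Fin p) =>
      weightedNorm (Matrix.of q.1)⁻¹ q.2) (fun q hq => by
        have h1 : q.1 = s := hq.1
        have : q = (s, q.2) := Prod.ext h1 rfl
        rw [this]
        exact continuousAt_weightedNorm_inv hSig q.2) (Metric.dist_mem_uniformity hδ)
  obtain ⟨ε, hε, hεu⟩ := Metric.mem_uniformity_dist.1 huc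
  refine ⟨ε, hε, fun N hN v hv u huv => ?_⟩
  let n : Fin p → Fin p → ℝ := N
  have hsn : dist s n < ε := by
    refine (dist_pi_lt_iff hε).2 fun a => (dist_pi_lt_iff hε).2 fun c => ?_
    rw [dist_comm, Real.dist_eq]
    exact hN a c
  have hvu : dist v u < ε := by rwa [dist_comm, dist_eq_norm]
  have hdist : dist (s, v) (n, u) < ε := by
    rw [Prod.dist_eq]
    exact max_lt hsn hvu
  have h := hεu hdist (Set.mk_mem_prod (Set.mem_singleton s) hv)
  exact h

/-! ### The square root of a positive definite matrix. -/

open scoped MatrixOrder Matrix.Norms.L2Operator in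
theorem matrixSqrt_mul_self {A : Matrix (Fin p) (Fin p) ℝ} (hA : A.PosDef) :
    matrixSqrt A * matrixSqrt A = A :=
  CFC.sqrt_mul_sqrt_self A hA.posSemidef.nonneg

open scoped MatrixOrder Matrix.Norms.L2Operator in
theorem transpose_matrixSqrt (A : Matrix (Fin p) (Fin p) ℝ) :
    (matrixSqrt A)ᵀ = matrixSqrt A := by
  have h : IsSelfAdjoint (CFC.sqrt A) := IsSelfAdjoint.of_nonneg (CFC.sqrt_nonneg A)
  rw [← Matrix.conjTranspose_eq_transpose_of_trivial]
  exact h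

theorem matrixSqrt_mul_inv_mul {A : Matrix (Fin p) (Fin p) ℝ} (hA : A.PosDef) :
    matrixSqrt A * (A⁻¹ * matrixSqrt A) = 1 := by
  have h := matrixSqrt_mul_self hA
  have hdet : IsUnit (matrixSqrt A).det := by
    have h1 : (matrixSqrt A).det * (matrixSqrt A).det = A.det := by rw [← Matrix.det_mul, h]
    refine isUnit_iff_ne_zero.2 fun h0 => hA.det_pos.ne' ?_
    rw [← h1, h0, zero_mul]
  have h2 : A⁻¹ = (matrixSqrt A)⁻¹ * (matrixSqrt A)⁻¹ := by
    conv_lhs => rw [← h]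
    rw [Matrix.mul_inv_rev]
  rw [h2, Matrix.mul_assoc, Matrix.nonsing_inv_mul _ hdet, Matrix.mul_one,
    Matrix.mul_nonsing_inv _ hdet]

/-- Multiplication by the square root of `A` turns the norm weighted by `A⁻¹` into the
unweighted one. -/
theorem weightedNorm_inv_matrixSqrt_mulVec {A : Matrix (Fin p) (Fin p) ℝ} (hA : A.PosDef)
    (y : EuclideanSpace ℝ (Fin p)) :
    weightedNorm A⁻¹ (WithLp.toLp 2 (matrixSqrt A *ᵥ y.ofLp)) = weightedNorm 1 y := by
  unfold weightedNorm
  congr 2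
  rw [Matrix.mulVec_mulVec, dotProduct_comm, Matrix.dotProduct_mulVec, ← Matrix.mulVec_transpose,
    Matrix.mulVec_mulVec, transpose_matrixSqrt, matrixSqrt_mul_inv_mul hA, dotProduct_comm]

/-! ### Weighted suprema of tied-down paths -/

/-- The tied-down path `k b_j - j b_k`. -/
noncomputable def tiedDown (b : ℕ → EuclideanSpace ℝ (Fin p)) (j k : ℕ) : EuclideanSpace ℝ (Fin p) :=
  (k : ℝ) • b j - (j : ℝ) • b k

/-- The weight `(m / k)^{3/2+η} / m^{3/2}`. -/
noncomputable def weight (η : ℝ) (m k : ℕ) : ℝ := ((m : ℝ) / k) ^ (3 / 2 + η) / (m : ℝ) ^ (3 / 2 : ℝ)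

/-- The weighted supremum of the tied-down path over `m ≤ j < k`. -/
noncomputable def tiedDownSup (η : ℝ) (M : Matrix (Fin p) (Fin p) ℝ) (m : ℕ)
    (b : ℕ → EuclideanSpace ℝ (Fin p)) : ℝ≥0∞ :=
  ⨆ (k : ℕ) (j : ℕ) (_ : m ≤ j) (_ : j < k),
    ENNReal.ofReal (weightedNorm M (weight η m k • tiedDown b j k))

theorem weight_nonneg (η : ℝ) (m k : ℕ) : 0 ≤ weight η m k := by
  unfold weight
  positivity

theorem tiedDown_sub_mul (b : ℕ → EuclideanSpace ℝ (Fin p)) (v : EuclideanSpace ℝ (Fin p))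
    (j k : ℕ) : tiedDown (fun i => b i - (i : ℝ) • v) j k = tiedDown b j k := by
  unfold tiedDown
  module

theorem tiedDown_mulVec (A : Matrix (Fin p) (Fin p) ℝ) (b : ℕ → EuclideanSpace ℝ (Fin p))
    (j k : ℕ) : tiedDown (fun i => WithLp.toLp 2 (A *ᵥ (b i).ofLp)) j k =
      WithLp.toLp 2 (A *ᵥ (tiedDown b j k).ofLp) := by
  unfold tiedDown
  simp [Matrix.mulVec_sub, Matrix.mulVec_smul]

theorem measurable_tiedDownSup {Ω : Type*} [MeasurableSpace Ω] (η : ℝ) (m : ℕ)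
    {M : Ω → Matrix (Fin p) (Fin p) ℝ} {b : Ω → ℕ → EuclideanSpace ℝ (Fin p)}
    (hM : ∀ a c, Measurable fun ω => M ω a c) (hb : ∀ i, Measurable fun ω => b ω i) :
    Measurable fun ω => tiedDownSup η (M ω) m (b ω) := by
  unfold tiedDownSup
  refine Measurable.iSup fun k => Measurable.iSup fun j => Measurable.iSup fun _ =>
    Measurable.iSup fun _ => ENNReal.measurable_ofReal.comp (measurable_weightedNorm hM ?_)
  unfold tiedDown
  have h1 := hb j
  have h2 := hb k
  fun_prop

theorem tiedDownSup_congr {η : ℝ} {M : Matrix (Fin p) (Fin p) ℝ} {m : ℕ}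
    {b b' : ℕ → EuclideanSpace ℝ (Fin p)} (h : ∀ i, m ≤ i → b i = b' i) :
    tiedDownSup η M m b = tiedDownSup η M m b' := by
  unfold tiedDownSup
  refine iSup_congr fun k => iSup_congr fun j => iSup_congr fun hj => iSup_congr fun hk => ?_
  unfold tiedDown
  rw [h j hj, h k (hj.trans hk.le)]

theorem le_tiedDownSup {η : ℝ} {M : Matrix (Fin p) (Fin p) ℝ} {m j k : ℕ}
    (b : ℕ → EuclideanSpace ℝ (Fin p)) (hj : m ≤ j) (hk : j < k) :
    ENNReal.ofReal (weightedNorm M (weight η m k • tiedDown b j k)) ≤ tiedDownSup η M m b :=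
  le_iSup₂_of_le k j (le_iSup₂_of_le hj hk le_rfl)

/-- Continuity of the weighted supremum in the matrix and the path, locally uniformly in the
path. -/
theorem exists_tiedDownSup_close {Sig : Matrix (Fin p) (Fin p) ℝ} (hSig : Sig.PosDef)
    {δ : ℝ} (hδ : 0 < δ) (C : ℝ) :
    ∃ ε > 0, ∀ (η : ℝ) (m : ℕ) (N : Matrix (Fin p) (Fin p) ℝ)
      (b b' : ℕ → EuclideanSpace ℝ (Fin p)), (∀ a c, |N a c - Sig a c| < ε) →
      tiedDownSup η 1 m b' ≤ ENNReal.ofReal C →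
      (∀ j k, m ≤ j → j < k → ‖weight η m k •
        tiedDown (fun i => b i - WithLp.toLp 2 (matrixSqrt Sig *ᵥ (b' i).ofLp)) j k‖ < ε) →
      tiedDownSup η N⁻¹ m b ≤ tiedDownSup η 1 m b' + ENNReal.ofReal δ ∧
      tiedDownSup η 1 m b' ≤ tiedDownSup η N⁻¹ m b + ENNReal.ofReal δ := by
  let A : EuclideanSpace ℝ (Fin p) → EuclideanSpace ℝ (Fin p) := fun y =>
    WithLp.toLp 2 (matrixSqrt Sig *ᵥ y.ofLp)
  have hA : Continuous A := by
    refine (PiLp.continuous_toLp 2 _).comp ?_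
    exact continuous_const.matrix_mulVec (PiLp.continuous_ofLp 2 _)
  -- The factor `√p` converts the weighted norm into the Euclidean one; `max C 0` covers negative
  -- `C`.
  obtain ⟨ε, hε, hclose⟩ := exists_weightedNorm_inv_close hSig
    ((isCompact_closedBall (0 : EuclideanSpace ℝ (Fin p)) (√p * max C 0)).image hA) hδ
  refine ⟨ε, hε, fun η m N b b' hN hC herr => ?_⟩
  have key : ∀ j k, m ≤ j → j < k →
      |weightedNorm 1 (weight η m k • tiedDown b' j k) -
        weightedNorm N⁻¹ (weight η m k • tiedDown b j k)| < δ := fun j k hj hk => by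
    have hb := (le_tiedDownSup (η := η) (M := 1) b' hj hk).trans hC
    have hb' : weightedNorm 1 (weight η m k • tiedDown b' j k) ≤ max C 0 := by
      have h0 : ENNReal.ofReal C ≤ ENNReal.ofReal (max C 0) :=
        ENNReal.ofReal_le_ofReal (le_max_left _ _)
      exact (ENNReal.ofReal_le_ofReal_iff (le_max_right _ _)).1 (hb.trans h0)
    have hAmem : A (weight η m k • tiedDown b' j k) ∈
        A '' Metric.closedBall 0 (√p * max C 0) := by
      refine Set.mem_image_of_mem _ ?_
      rw [mem_closedBall_zero_iff, norm_eq_sqrt_mul_weightedNorm_one]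
      gcongr
    have hdist : ‖weight η m k • tiedDown b j k - A (weight η m k • tiedDown b' j k)‖ < ε := by
      have h1 : A (weight η m k • tiedDown b' j k) =
          weight η m k • tiedDown (fun i => A (b' i)) j k := by
        rw [tiedDown_mulVec]
        simp [A, Matrix.mulVec_smul]
      have h2 : tiedDown b j k - tiedDown (fun i => A (b' i)) j k =
          tiedDown (fun i => b i - A (b' i)) j k := by
        unfold tiedDown
        module
      rw [h1, ← smul_sub, h2]
      exact herr j k hj hk
    rw [← weightedNorm_inv_matrixSqrt_mulVec hSig]
    exact hclose N hN _ hAmem _ hdist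
  constructor
  · refine iSup₂_le fun k j => iSup₂_le fun hj hk => ?_
    refine le_trans ?_ (add_le_add_left (le_tiedDownSup b' hj hk) _)
    rw [← ENNReal.ofReal_add (weightedNorm_nonneg _ _) hδ.le]
    exact ENNReal.ofReal_le_ofReal (by linarith [(abs_lt.1 (key j k hj hk)).1])
  · refine iSup₂_le fun k j => iSup₂_le fun hj hk => ?_
    refine le_trans ?_ (add_le_add_left (le_tiedDownSup b hj hk) _)
    rw [← ENNReal.ofReal_add (weightedNorm_nonneg _ _) hδ.le]
    exact ENNReal.ofReal_le_ofReal (by linarith [(abs_lt.1 (key j k hj hk)).2])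

/-- The weights damp errors of polynomial order. -/
theorem norm_weight_smul_tiedDown_le {η ξ R : ℝ} (hη : 0 < η) (hξ : 0 < ξ) (hξ' : ξ < 1 / 2)
    (hR : 0 ≤ R) {m : ℕ} (hm : 1 ≤ m) {e : ℕ → EuclideanSpace ℝ (Fin p)}
    (he : ∀ k, m ≤ k → ‖e k‖ ≤ R * (k : ℝ) ^ ξ) {j k : ℕ} (hj : m ≤ j) (hk : j < k) :
    ‖weight η m k • tiedDown e j k‖ ≤ 2 * R * (m : ℝ) ^ (-(1 / 2 - ξ)) := by
  have hm0 : (0 : ℝ) < m := by exact_mod_cast hm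
  have hmj : (m : ℝ) ≤ j := by exact_mod_cast hj
  have hjk : (j : ℝ) ≤ k := by exact_mod_cast hk.le
  have hk0 : (0 : ℝ) < k := by linarith
  have h1 : ‖tiedDown e j k‖ ≤ 2 * R * (k : ℝ) ^ (1 + ξ) := by
    unfold tiedDown
    refine (norm_sub_le _ _).trans ?_
    rw [norm_smul, norm_smul, Real.norm_natCast, Real.norm_natCast, Real.rpow_add hk0,
      Real.rpow_one]
    have e1 : ‖e j‖ ≤ R * (k : ℝ) ^ ξ := (he j hj).trans (by gcongr)
    have e2 : ‖e k‖ ≤ R * (k : ℝ) ^ ξ := he k (hj.trans hk.le)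
    have e3 : (j : ℝ) * ‖e k‖ ≤ k * (R * (k : ℝ) ^ ξ) := by gcongr
    have e4 : (k : ℝ) * ‖e j‖ ≤ k * (R * (k : ℝ) ^ ξ) := by gcongr
    linarith
  -- Since m/k ≤ 1 and 1 + ξ ≤ 3/2 + η, the exponent may be lowered to the one that cancels k^{1+ξ}.
  have h2 : weight η m k ≤ ((m : ℝ) / k) ^ (1 + ξ) / (m : ℝ) ^ (3 / 2 : ℝ) := by
    unfold weight
    gcongr ?_ / _
    refine Real.rpow_le_rpow_of_exponent_ge (by positivity) ?_ (by linarith)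
    exact div_le_one_of_le₀ (hmj.trans hjk) hk0.le
  rw [norm_smul, Real.norm_of_nonneg (weight_nonneg _ _ _)]
  calc weight η m k * ‖tiedDown e j k‖
      ≤ ((m : ℝ) / k) ^ (1 + ξ) / (m : ℝ) ^ (3 / 2 : ℝ) * (2 * R * (k : ℝ) ^ (1 + ξ)) := by
        gcongr
    _ = 2 * R * (m : ℝ) ^ (-(1 / 2 - ξ)) := by
        rw [Real.div_rpow hm0.le hk0.le]
        have h3 : (m : ℝ) ^ (-(1 / 2 - ξ)) = (m : ℝ) ^ (1 + ξ) / (m : ℝ) ^ (3 / 2 : ℝ) := by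
          rw [← Real.rpow_sub hm0]
          congr 1
          ring
        rw [h3]
        field_simp

end OpenEnd

namespace OpenEnd

/-! ### The detector and the limit variable as weighted suprema -/

theorem smul_empCDFVec_sub {Ω : Type*} {d p : ℕ} (X : ℕ → Ω → (Fin d → ℝ))
    (x : Fin p → (Fin d → ℝ)) {j k : ℕ} (hj : 1 ≤ j) (hk : j < k) (ω : Ω) :
    ((j : ℝ) * ((k : ℝ) - j)) • (empCDFVec X x 0 j ω - empCDFVec X x j k ω) =
      tiedDown (fun n => ∑ i ∈ Finset.range n, indicatorSeries X x i ω) j k := by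
  have hj0 : (j : ℝ) ≠ 0 := by positivity
  have hk0 : (k : ℝ) - j ≠ 0 := sub_ne_zero.2 (by exact_mod_cast hk.ne')
  ext a
  simp only [empCDFVec, empCDF, tiedDown, indicatorSeries, PiLp.smul_apply, PiLp.sub_apply,
    WithLp.ofLp_sum, Finset.sum_apply, smul_eq_mul, Finset.sum_Ico_eq_sub _ hk.le,
    Finset.range_eq_Ico, Nat.cast_zero, sub_zero]
  field_simp
  ring

/-- The limit statements are indexed by all of ℕ, so the identities behind them must also hold at m
= 0, where the weight contains the factor `0 ^ (3/2 + η) = 0`. -/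
theorem tiedDownSup_zero {p : ℕ} {η : ℝ} (hη : 0 < η) (M : Matrix (Fin p) (Fin p) ℝ)
    (b : ℕ → EuclideanSpace ℝ (Fin p)) : tiedDownSup η M 0 b = 0 := by
  have h : 3 / 2 + η ≠ 0 := by positivity
  simp [tiedDownSup, weight, weightedNorm, Real.zero_rpow h]

/-- The inner maximum runs over a finite nonempty set, so it is attained and merges with the
supremum over `k`. -/
theorem scaledSupDetector_eq_tiedDownSup {Ω : Type*} {d p : ℕ} (X : ℕ → Ω → (Fin d → ℝ))
    (x : Fin p → (Fin d → ℝ))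
    (S : (m : ℕ) → (Fin m → EuclideanSpace ℝ (Fin p)) → Matrix (Fin p) (Fin p) ℝ)
    {η : ℝ} (hη : 0 < η) (m : ℕ) (ω : Ω) :
    scaledSupDetector X x S η m ω =
      tiedDownSup η (estimate (indicatorSeries X x) S m ω)⁻¹ m
        (fun n => ∑ i ∈ Finset.range n, indicatorSeries X x i ω) := by
  rcases Nat.eq_zero_or_pos m with rfl | (hm : 1 ≤ m)
  · rw [tiedDownSup_zero hη]
    have h : 3 / 2 + η ≠ 0 := by positivity
    simp [scaledSupDetector, Real.zero_rpow h]
  set M := (estimate (indicatorSeries X x) S m ω)⁻¹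
  have hterm : ∀ j k : ℕ, m ≤ j → j < k →
      ((m : ℝ) / (k : ℝ)) ^ (3 / 2 + η) * ((j : ℝ) * ((k : ℝ) - j) / (m : ℝ) ^ (3 / 2 : ℝ) *
        weightedNorm M (empCDFVec X x 0 j ω - empCDFVec X x j k ω)) =
      weightedNorm M (weight η m k •
        tiedDown (fun n => ∑ i ∈ Finset.range n, indicatorSeries X x i ω) j k) := by
    intro j k hj hk
    have hjk : (0 : ℝ) ≤ (k : ℝ) - j := sub_nonneg.2 (by exact_mod_cast hk.le)
    rw [← smul_empCDFVec_sub X x (hm.trans hj) hk, weightedNorm_smul _ (weight_nonneg _ _ _),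
      weightedNorm_smul _ (by positivity)]
    unfold weight
    ring
  refine le_antisymm (iSup₂_le fun k hk => ?_)
    (iSup₂_le fun k j => iSup₂_le fun hj hk => le_iSup₂_of_le k (hj.trans_lt hk) ?_)
  · have : Nonempty (Finset.Ico m k) := ⟨⟨m, Finset.mem_Ico.2 ⟨le_rfl, hk⟩⟩⟩
    obtain ⟨⟨j, hj⟩, hmax⟩ := exists_eq_ciSup_of_finite (f := fun j : Finset.Ico m k =>
      ((j : ℕ) : ℝ) * ((k : ℝ) - ((j : ℕ) : ℝ)) / (m : ℝ) ^ (3 / 2 : ℝ) *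
        weightedNorm M (empCDFVec X x 0 j ω - empCDFVec X x j k ω))
    have hj' := Finset.mem_Ico.1 hj
    have hd : detector X x S m k ω = _ := hmax.symm
    rw [hd, hterm j k hj'.1 hj'.2]
    exact le_tiedDownSup _ hj'.1 hj'.2
  · rw [← hterm j k hj hk]
    refine ENNReal.ofReal_le_ofReal ?_
    gcongr
    exact le_ciSup (f := fun j : Finset.Ico m k =>
      ((j : ℕ) : ℝ) * ((k : ℝ) - ((j : ℕ) : ℝ)) / (m : ℝ) ^ (3 / 2 : ℝ) *
        weightedNorm M (empCDFVec X x 0 j ω - empCDFVec X x j k ω))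
      (Set.finite_range _).bddAbove ⟨j, Finset.mem_Ico.2 ⟨hj, hk⟩⟩

variable {p : ℕ} {Ω : Type*}

/-- The functional of which `limitVariable` is the supremum. -/
noncomputable def limitFunctional (η : ℝ) (w : ℝ≥0 → EuclideanSpace ℝ (Fin p)) (s t : ℝ≥0) : ℝ :=
  (t : ℝ) ^ (-(3 / 2) - η) *
    weightedNorm (1 : Matrix (Fin p) (Fin p) ℝ) ((t : ℝ) • w s - (s : ℝ) • w t)

theorem limitFunctional_le_limitVariable (η : ℝ) (W : ℝ≥0 → Ω → EuclideanSpace ℝ (Fin p)) (ω : Ω)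
    {s t : ℝ≥0} (hs : 1 ≤ s) (hst : s ≤ t) :
    ENNReal.ofReal (limitFunctional η (W · ω) s t) ≤ limitVariable η W ω :=
  le_iSup₂_of_le s t (le_iSup₂_of_le hs hst le_rfl)

/-- Brownian scaling: one factor m comes from rescaling time, one √m from rescaling space, and
together they cancel the m^{3/2} in the weight. -/
theorem weightedNorm_weight_smul_tiedDown_scaled (η : ℝ) (w : ℝ≥0 → EuclideanSpace ℝ (Fin p))
    {m k : ℕ} (hm : 1 ≤ m) (hk : 1 ≤ k) (j : ℕ) :
    weightedNorm 1 (weight η m k • tiedDown (fun i => √m • w (i / m)) j k) =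
      limitFunctional η w (j / m) (k / m) := by
  have hm0 : (0 : ℝ) < m := by exact_mod_cast hm
  have hk0 : (0 : ℝ) < k := by exact_mod_cast hk
  have h1 : tiedDown (fun i => √m • w (i / m)) j k =
      ((m : ℝ) * √m) • ((((k / m : ℝ≥0) : ℝ)) • w (j / m) -
        (((j / m : ℝ≥0) : ℝ)) • w (k / m)) := by
    unfold tiedDown
    simp only [NNReal.coe_div, NNReal.coe_natCast, smul_sub, smul_smul]
    congr 2 <;> field_simp
  rw [h1, smul_smul, weightedNorm_smul _ (by have := weight_nonneg η m k; positivity)]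
  unfold limitFunctional weight
  congr 1
  have h2 : (m : ℝ) * √m = (m : ℝ) ^ (3 / 2 : ℝ) := by
    rw [Real.sqrt_eq_rpow, ← Real.rpow_one_add' hm0.le (by norm_num)]
    norm_num
  have h3 : -(3 / 2) - η = -(3 / 2 + η) := by ring
  rw [h2, div_mul_cancel₀ _ (by positivity), NNReal.coe_div, NNReal.coe_natCast,
    NNReal.coe_natCast, h3, Real.rpow_neg (by positivity), ← Real.inv_rpow (by positivity),
    inv_div]

theorem tiedDownSup_scaled_le_limitVariable (η : ℝ) (W : ℝ≥0 → Ω → EuclideanSpace ℝ (Fin p))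
    (ω : Ω) {m : ℕ} (hm : 1 ≤ m) :
    tiedDownSup η 1 m (fun j => √m • W (j / m) ω) ≤ limitVariable η W ω := by
  refine iSup₂_le fun k j => iSup₂_le fun hj hk => ?_
  have hm0 : (0 : ℝ≥0) < m := by exact_mod_cast hm
  rw [weightedNorm_weight_smul_tiedDown_scaled η (W · ω) hm (by omega)]
  refine limitFunctional_le_limitVariable η W ω ?_ ?_
  · rw [one_le_div hm0]
    exact_mod_cast hj
  · gcongr

theorem continuousAt_limitFunctional (η : ℝ) {w : ℝ≥0 → EuclideanSpace ℝ (Fin p)}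
    (hw : Continuous w) (s : ℝ≥0) {t : ℝ≥0} (ht : 0 < t) :
    ContinuousAt (fun q : ℝ≥0 × ℝ≥0 => limitFunctional η w q.1 q.2) (s, t) := by
  have h1 : ContinuousAt (fun q : ℝ≥0 × ℝ≥0 => (q.2 : ℝ) ^ (-(3 / 2) - η)) (s, t) := by
    refine ContinuousAt.rpow_const (by fun_prop) (Or.inl ?_)
    simpa using ht.ne'
  unfold limitFunctional
  simp_rw [weightedNorm_one]
  refine h1.mul (Continuous.continuousAt ?_)
  fun_prop

theorem tendsto_natCeil_mul_div (s : ℝ≥0) :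
    Tendsto (fun m : ℕ => (⌈s * m⌉₊ : ℝ≥0) / m) atTop (𝓝 s) := by
  rw [← NNReal.tendsto_coe]
  exact (tendsto_nat_ceil_mul_div_atTop (R := ℝ) s.2).comp tendsto_natCast_atTop_atTop

/-- Along a continuous path, the suprema over finer and finer grids converge to the supremum over
the half-line. -/
theorem tendsto_tiedDownSup_scaled (η : ℝ) (W : ℝ≥0 → Ω → EuclideanSpace ℝ (Fin p)) (ω : Ω)
    (hW : Continuous (W · ω)) :
    Tendsto (fun m : ℕ => tiedDownSup η 1 m (fun j => √m • W (j / m) ω)) atTop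
      (𝓝 (limitVariable η W ω)) := by
  refine tendsto_order.2 ⟨fun a ha => ?_, fun a ha => ?_⟩
  · obtain ⟨s, ha⟩ := lt_iSup_iff.1 ha
    obtain ⟨t, ha⟩ := lt_iSup_iff.1 ha
    obtain ⟨hs, ha⟩ := lt_iSup_iff.1 ha
    obtain ⟨hst, ha⟩ := lt_iSup_iff.1 ha
    have ha : a < ENNReal.ofReal (limitFunctional η (W · ω) s t) := ha
    -- The functional vanishes on the diagonal, so s < t, as the discrete supremum requires j < k.
    -- Rounding up below keeps the grid index at least `m`.
    have hne : s ≠ t := by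
      rintro rfl
      simp [limitFunctional, weightedNorm] at ha
    have hlt : s < t := lt_of_le_of_ne hst hne
    have hlim := (tendsto_natCeil_mul_div s).prodMk_nhds (tendsto_natCeil_mul_div t)
    have hG := (ENNReal.continuous_ofReal.tendsto _).comp
      ((continuousAt_limitFunctional η hW s (lt_of_lt_of_le zero_lt_one (hs.trans hst))).tendsto.comp
        hlim)
    have hjk := (tendsto_natCeil_mul_div s).eventually_lt (tendsto_natCeil_mul_div t) hlt
    filter_upwards [hG.eventually (lt_mem_nhds ha), hjk, eventually_ge_atTop 1] with m h1 h2 hm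
    have hm0 : (0 : ℝ≥0) < m := by exact_mod_cast hm
    have hjk' : ⌈s * m⌉₊ < ⌈t * m⌉₊ := by
      exact_mod_cast (div_lt_div_iff_of_pos_right hm0).1 h2
    have hj : m ≤ ⌈s * m⌉₊ := by
      have : (m : ℝ≥0) ≤ s * m := le_mul_of_one_le_left zero_le hs
      exact_mod_cast this.trans (Nat.le_ceil _)
    refine h1.trans_le ?_
    refine le_trans (le_of_eq ?_)
      (le_tiedDownSup (fun j => √m • W (j / m) ω) hj hjk')
    rw [weightedNorm_weight_smul_tiedDown_scaled η (W · ω) hm (by omega)]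
    rfl
  · filter_upwards [eventually_ge_atTop 1] with m hm
    exact (tiedDownSup_scaled_le_limitVariable η W ω hm).trans_lt ha

theorem IsStdBrownian.ae_continuous [MeasurableSpace Ω] {Q : Measure Ω}
    {W : ℝ≥0 → Ω → EuclideanSpace ℝ (Fin p)} (hW : IsStdBrownian W Q) :
    ∀ᵐ ω ∂Q, Continuous (W · ω) := by
  filter_upwards [ae_all_iff.2 fun a => (hW.coord a).cont] with ω hω
  exact (PiLp.continuous_toLp 2 fun _ : Fin p => ℝ).comp (continuous_pi hω)

/-- For s ≤ t the growth bound makes both terms at most K t^{3/2+η}, which the weight cancels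
exactly. -/
theorem ae_limitVariable_lt_top [MeasurableSpace Ω] {Q : Measure Ω}
    {W : ℝ≥0 → Ω → EuclideanSpace ℝ (Fin p)} (hW : IsStdBrownian W Q) {η : ℝ} (hη : 0 < η) :
    ∀ᵐ ω ∂Q, limitVariable η W ω < ∞ := by
  filter_upwards [ae_all_iff.2 fun a => ae_exists_abs_le_rpow (hW.coord a) hη] with ω hω
  choose C hC using hω
  have hnorm : ∀ t : ℝ≥0, 1 ≤ t → ‖W t ω‖ ≤ (∑ a, C a) * (t : ℝ) ^ (1 / 2 + η) := fun t ht => by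
    calc ‖W t ω‖ = √(∑ a, |W t ω a| ^ 2) := EuclideanSpace.norm_eq _
      _ ≤ ∑ a, |W t ω a| := by
          refine Real.sqrt_le_iff.2 ⟨Finset.sum_nonneg fun _ _ => abs_nonneg _, ?_⟩
          exact Finset.sum_sq_le_sq_sum_of_nonneg fun _ _ => abs_nonneg _
      _ ≤ ∑ a, C a * (t : ℝ) ^ (1 / 2 + η) := Finset.sum_le_sum fun a _ => hC a t ht
      _ = _ := (Finset.sum_mul _ _ _).symm
  set K := ∑ a, C a
  refine lt_of_le_of_lt ?_ (ENNReal.ofReal_lt_top (r := 2 * K / √p))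
  refine iSup₂_le fun s t => iSup₂_le fun hs hst => ENNReal.ofReal_le_ofReal ?_
  have ht1 : (1 : ℝ) ≤ t := by exact_mod_cast hs.trans hst
  have hs1 : (1 : ℝ) ≤ s := by exact_mod_cast hs
  have hst' : (s : ℝ) ≤ t := by exact_mod_cast hst
  have ht0 : (0 : ℝ) < t := by linarith
  have hK : 0 ≤ K := by
    have := (norm_nonneg _).trans (hnorm 1 le_rfl)
    simpa using this
  have h1 : ‖(t : ℝ) • W s ω - (s : ℝ) • W t ω‖ ≤ 2 * K * (t : ℝ) ^ (3 / 2 + η) := by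
    refine (norm_sub_le _ _).trans ?_
    rw [norm_smul, norm_smul, Real.norm_of_nonneg ht0.le, Real.norm_of_nonneg (by linarith)]
    have e1 : ‖W s ω‖ ≤ K * (t : ℝ) ^ (1 / 2 + η) := by
      refine (hnorm s hs).trans ?_
      gcongr
    have e2 := hnorm t (hs.trans hst)
    have e3 : (t : ℝ) ^ (3 / 2 + η) = t * (t : ℝ) ^ (1 / 2 + η) := by
      rw [← Real.rpow_one_add' ht0.le (by linarith)]
      congr 1
      ring
    have e4 : (s : ℝ) * ‖W t ω‖ ≤ t * (K * (t : ℝ) ^ (1 / 2 + η)) := by gcongr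
    have e5 : (t : ℝ) * ‖W s ω‖ ≤ t * (K * (t : ℝ) ^ (1 / 2 + η)) := by gcongr
    rw [e3]
    linarith
  rw [weightedNorm_one, ← mul_div_assoc]
  gcongr ?_ / _
  calc (t : ℝ) ^ (-(3 / 2) - η) * ‖(t : ℝ) • W s ω - (s : ℝ) • W t ω‖
      ≤ (t : ℝ) ^ (-(3 / 2) - η) * (2 * K * (t : ℝ) ^ (3 / 2 + η)) := by gcongr
    _ = 2 * K * ((t : ℝ) ^ (-(3 / 2) - η) * (t : ℝ) ^ (3 / 2 + η)) := by ring
    _ = 2 * K := by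
        rw [← Real.rpow_add ht0]
        norm_num

end OpenEnd

namespace OpenEnd

/-! ### Convergence in distribution in `[0, ∞]` -/

/-- A homeomorphism of `[0, ∞]` onto `[0, 1]`. -/
noncomputable def compress (x : ℝ≥0∞) : ℝ := ((1 + x)⁻¹).toReal

/-- A continuous left inverse of `compress`. -/
noncomputable def uncompress (r : ℝ) : ℝ≥0∞ := (ENNReal.ofReal r)⁻¹ - 1

theorem continuous_compress : Continuous compress := by
  refine continuous_iff_continuousAt.2 fun x => ?_
  have h : (1 + x)⁻¹ ≠ ∞ := ENNReal.inv_ne_top.2 (by simp)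
  have h1 : Continuous fun y : ℝ≥0∞ => (1 + y)⁻¹ := by fun_prop
  exact (ENNReal.tendsto_toReal h).comp h1.continuousAt

theorem continuous_uncompress : Continuous uncompress :=
  (ENNReal.continuous_sub_right 1).comp ENNReal.continuous_ofReal.inv

theorem uncompress_compress (x : ℝ≥0∞) : uncompress (compress x) = x := by
  have h : (1 + x)⁻¹ ≠ ∞ := ENNReal.inv_ne_top.2 (by simp)
  rw [uncompress, compress, ENNReal.ofReal_toReal h, inv_inv,
    ENNReal.add_sub_cancel_left ENNReal.one_ne_top]

/-- The map z ↦ 1/(1+z) is decreasing and 1-Lipschitz; at y = ∞ it takes its least value 0. -/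
theorem compress_sub_le {x y : ℝ≥0∞} {δ : ℝ} (hδ : 0 ≤ δ) (h : x ≤ y + ENNReal.ofReal δ) :
    compress y - compress x ≤ δ := by
  have hx0 : 0 ≤ compress x := ENNReal.toReal_nonneg
  rcases eq_or_ne y ∞ with rfl | hy
  · have : compress ∞ = 0 := by simp [compress]
    linarith
  have hx : x ≠ ∞ := ne_top_of_le_ne_top (by finiteness) h
  have hval : ∀ z : ℝ≥0∞, z ≠ ∞ → compress z = (1 + z.toReal)⁻¹ := fun z hz => by
    rw [compress, ENNReal.toReal_inv, ENNReal.toReal_add ENNReal.one_ne_top hz,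
      ENNReal.toReal_one]
  have hab : x.toReal ≤ y.toReal + δ := by
    have := ENNReal.toReal_mono (by finiteness) h
    rwa [ENNReal.toReal_add hy (by finiteness), ENNReal.toReal_ofReal hδ] at this
  rw [hval x hx, hval y hy]
  have ha : 0 ≤ x.toReal := ENNReal.toReal_nonneg
  have hb : 0 ≤ y.toReal := ENNReal.toReal_nonneg
  generalize x.toReal = a at *
  generalize y.toReal = b at *
  rw [inv_sub_inv (by positivity) (by positivity), div_le_iff₀ (by positivity)]
  nlinarith [mul_nonneg hδ ha, mul_nonneg hδ hb, mul_nonneg hδ (mul_nonneg ha hb)]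

theorem abs_compress_sub_le {x y : ℝ≥0∞} {δ : ℝ} (hδ : 0 ≤ δ) (h : x ≤ y + ENNReal.ofReal δ)
    (h' : y ≤ x + ENNReal.ofReal δ) : |compress x - compress y| ≤ δ :=
  abs_sub_le_iff.2 ⟨compress_sub_le hδ h', compress_sub_le hδ h⟩

theorem TendstoInDistribution.of_identDistrib {ι E : Type*} {Ω Ω₁ : ι → Type*} {Ω' : Type*}
    [∀ i, MeasurableSpace (Ω i)] [∀ i, MeasurableSpace (Ω₁ i)] [MeasurableSpace Ω']
    {μ : ∀ i, Measure (Ω i)} [∀ i, IsProbabilityMeasure (μ i)]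
    {ν : ∀ i, Measure (Ω₁ i)} [∀ i, IsProbabilityMeasure (ν i)]
    {μ' : Measure Ω'} [IsProbabilityMeasure μ'] [TopologicalSpace E] [MeasurableSpace E]
    [OpensMeasurableSpace E] {X : ∀ i, Ω i → E} {Y : ∀ i, Ω₁ i → E} {Z : Ω' → E} {l : Filter ι}
    (h : TendstoInDistribution Y l Z ν μ')
    (hXY : ∀ i, IdentDistrib (X i) (Y i) (μ i) (ν i)) : TendstoInDistribution X l Z μ μ' where
  forall_aemeasurable i := (hXY i).aemeasurable_fst
  aemeasurable_limit := h.aemeasurable_limit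
  tendsto := by
    refine h.tendsto.congr fun i => ?_
    exact Subtype.ext (hXY i).map_eq.symm

/-- Slutsky's theorem for `[0, ∞]`-valued random variables: if `X n` converges in distribution,
and `X n` and `Y n` are close with high probability, then `Y n` has the same limit. -/
theorem tendstoInDistribution_of_close {Ω Ω' : Type*} [MeasurableSpace Ω] [MeasurableSpace Ω']
    {P : Measure Ω} [IsProbabilityMeasure P] {Q : Measure Ω'} [IsProbabilityMeasure Q]
    {X Y : ℕ → Ω → ℝ≥0∞} {Z : Ω' → ℝ≥0∞}
    (hX : TendstoInDistribution X atTop Z (fun _ => P) Q) (hY : ∀ n, AEMeasurable (Y n) P)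
    (hXY : ∀ δ : ℝ, 0 < δ → Tendsto (fun n => P {ω | ¬ (Y n ω ≤ X n ω + ENNReal.ofReal δ ∧
      X n ω ≤ Y n ω + ENNReal.ofReal δ)}) atTop (𝓝 0)) :
    TendstoInDistribution Y atTop Z (fun _ => P) Q := by
  have h1 := hX.continuous_comp continuous_compress
  -- Slutsky's theorem is applied to differences, which make sense after compression to real values.
  have h2 : TendstoInMeasure P ((fun n => compress ∘ Y n) - fun n => compress ∘ X n) atTop 0 := by
    rw [tendstoInMeasure_iff_norm]
    intro δ hδ
    refine tendsto_of_tendsto_of_tendsto_of_le_of_le tendsto_const_nhds (hXY (δ / 2) (half_pos hδ))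
      (fun _ => zero_le) fun n => measure_mono fun ω hω => ?_
    intro hclose
    have hle := abs_compress_sub_le (half_pos hδ).le hclose.1 hclose.2
    have hω' : δ ≤ |compress (Y n ω) - compress (X n ω)| := by simpa using hω
    linarith
  have h3 := tendstoInDistribution_of_tendstoInMeasure_sub _ _ h1 h2
    fun n => continuous_compress.measurable.comp_aemeasurable (hY n)
  have h4 := h3.continuous_comp continuous_uncompress
  simpa only [← Function.comp_assoc, Function.comp_def, uncompress_compress] using h4

/-! ### The Gaussian approximation -/

variable {p : ℕ}

/-- Split the sum at `m`: the two blocks contribute at most C₂ m^ξ and C₁ (k-m)^ξ, both controlled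
by k^ξ. At k = m the second block is empty and `w₁ 0 = 0` is needed. -/
theorem norm_sum_sub_le_of_approx {y w₁ : ℕ → EuclideanSpace ℝ (Fin p)}
    {w₂ v : EuclideanSpace ℝ (Fin p)} {A : Matrix (Fin p) (Fin p) ℝ} {ξ : ℝ} (hξ : 0 < ξ)
    {C₁ C₂ : ℝ≥0} {m : ℕ} (hm : 1 ≤ m) (hw : w₁ 0 = 0)
    (h₁ : ∀ k, m < k → ENNReal.ofReal (1 / ((k : ℝ) - m) ^ ξ *
      ‖∑ i ∈ Finset.Ico m k, (y i - v) - WithLp.toLp 2 (A *ᵥ (w₁ (k - m)).ofLp)‖) ≤ C₁)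
    (h₂ : ENNReal.ofReal (1 / (m : ℝ) ^ ξ *
      ‖∑ i ∈ Finset.Ico 0 m, (y i - v) - WithLp.toLp 2 (A *ᵥ w₂.ofLp)‖) ≤ C₂)
    {k : ℕ} (hk : m ≤ k) :
    ‖∑ i ∈ Finset.range k, y i - WithLp.toLp 2 (A *ᵥ (w₂ + w₁ (k - m)).ofLp) - (k : ℝ) • v‖ ≤
      ((C₁ + C₂ : ℝ≥0) : ℝ) * (k : ℝ) ^ ξ := by
  have hm0 : (0 : ℝ) < m := by exact_mod_cast hm
  have hmk : (m : ℝ) ≤ k := by exact_mod_cast hk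
  have e2 : ‖∑ i ∈ Finset.Ico 0 m, (y i - v) - WithLp.toLp 2 (A *ᵥ w₂.ofLp)‖ ≤
      C₂ * (k : ℝ) ^ ξ := by
    rw [← ENNReal.ofReal_coe_nnreal, ENNReal.ofReal_le_ofReal_iff (NNReal.coe_nonneg C₂), one_div,
      inv_mul_le_iff₀ (by positivity), mul_comm] at h₂
    refine h₂.trans ?_
    gcongr
  have e1 : ‖∑ i ∈ Finset.Ico m k, (y i - v) - WithLp.toLp 2 (A *ᵥ (w₁ (k - m)).ofLp)‖ ≤
      C₁ * (k : ℝ) ^ ξ := by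
    rcases hk.eq_or_lt with rfl | hlt
    · simp only [Finset.Ico_self, Finset.sum_empty, tsub_self, hw, WithLp.ofLp_zero,
        Matrix.mulVec_zero, WithLp.toLp_zero, sub_zero, norm_zero]
      positivity
    · have h := h₁ k hlt
      have hpos : (0 : ℝ) < (k : ℝ) - m := sub_pos.2 (by exact_mod_cast hlt)
      rw [← ENNReal.ofReal_coe_nnreal, ENNReal.ofReal_le_ofReal_iff (NNReal.coe_nonneg C₁), one_div,
        inv_mul_le_iff₀ (by positivity), mul_comm] at h
      refine h.trans ?_
      gcongr
      linarith
  have hsplit : ∑ i ∈ Finset.range k, y i - WithLp.toLp 2 (A *ᵥ (w₂ + w₁ (k - m)).ofLp) -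
      (k : ℝ) • v =
      (∑ i ∈ Finset.Ico m k, (y i - v) - WithLp.toLp 2 (A *ᵥ (w₁ (k - m)).ofLp)) +
      (∑ i ∈ Finset.Ico 0 m, (y i - v) - WithLp.toLp 2 (A *ᵥ w₂.ofLp)) := by
    have h3 : ∑ i ∈ Finset.range k, (y i - v) = ∑ i ∈ Finset.range k, y i - (k : ℝ) • v := by
      rw [Finset.sum_sub_distrib, Finset.sum_const, Finset.card_range, Nat.cast_smul_eq_nsmul]
    have h4 := Finset.sum_Ico_consecutive (fun i => y i - v) (Nat.zero_le m) hk
    rw [← Finset.range_eq_Ico (a := k), h3] at h4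
    rw [WithLp.ofLp_add, Matrix.mulVec_add, WithLp.toLp_add, sub_right_comm, ← h4]
    abel
  rw [hsplit]
  refine (norm_add_le _ _).trans ?_
  push_cast
  linarith

/-! ### Measurability of the statistic through the finite range of the indicators. -/

section Rounding

/-- The pattern of coordinates of a vector that are equal to `1`. -/
noncomputable def onesPattern (y : EuclideanSpace ℝ (Fin p)) (a : Fin p) : Bool :=
  decide (y a = 1)

/-- The vector with entries in `{0, 1}` with a given pattern of ones. -/
noncomputable def ofOnesPattern (f : Fin p → Bool) : EuclideanSpace ℝ (Fin p) :=
  WithLp.toLp 2 fun a => if f a then 1 else 0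

theorem measurable_onesPattern : Measurable (onesPattern (p := p)) := by
  refine measurable_pi_lambda _ fun a => ?_
  have h : MeasurableSet {y : EuclideanSpace ℝ (Fin p) | y a = 1} :=
    (by fun_prop : Measurable fun y : EuclideanSpace ℝ (Fin p) => y a) (measurableSet_singleton 1)
  refine measurable_to_bool ?_
  convert h using 1
  ext y
  simp [onesPattern]

theorem ofOnesPattern_onesPattern_indicatorSeries {Ω : Type*} {d : ℕ} (X : ℕ → Ω → (Fin d → ℝ))
    (x : Fin p → (Fin d → ℝ)) (i : ℕ) (ω : Ω) :
    ofOnesPattern (onesPattern (indicatorSeries X x i ω)) = indicatorSeries X x i ω := by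
  ext a
  by_cases h : X i ω ≤ x a <;>
    simp [ofOnesPattern, onesPattern, indicatorSeries, Set.indicator, h]

/-- The estimator computed from the rounded variables. -/
noncomputable def roundedEstimator
    (S : (m : ℕ) → (Fin m → EuclideanSpace ℝ (Fin p)) → Matrix (Fin p) (Fin p) ℝ)
    (m : ℕ) (y : ℕ → EuclideanSpace ℝ (Fin p)) : Matrix (Fin p) (Fin p) ℝ :=
  S m fun i => ofOnesPattern (onesPattern (y i))

/-- The map factors through the finite set of patterns, on which every function is measurable. In
use, `g` is an entry of the matrix or of its inverse. -/
theorem measurable_comp_roundedEstimator {β : Type*} [MeasurableSpace β]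
    (S : (m : ℕ) → (Fin m → EuclideanSpace ℝ (Fin p)) → Matrix (Fin p) (Fin p) ℝ)
    (m : ℕ) (g : Matrix (Fin p) (Fin p) ℝ → β) :
    Measurable fun y => g (roundedEstimator S m y) := by
  have h1 : Measurable fun (y : ℕ → EuclideanSpace ℝ (Fin p)) (i : Fin m) =>
      onesPattern (y i) :=
    measurable_pi_lambda _ fun i => measurable_onesPattern.comp (measurable_pi_apply _)
  have h2 : Measurable fun f : Fin m → Fin p → Bool => g (S m fun i => ofOnesPattern (f i)) :=
    measurable_of_finite _
  exact h2.comp h1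

theorem roundedEstimator_indicatorSeries {Ω : Type*} {d : ℕ} (X : ℕ → Ω → (Fin d → ℝ))
    (x : Fin p → (Fin d → ℝ))
    (S : (m : ℕ) → (Fin m → EuclideanSpace ℝ (Fin p)) → Matrix (Fin p) (Fin p) ℝ)
    (m : ℕ) (ω : Ω) :
    roundedEstimator S m (fun i => indicatorSeries X x i ω) =
      estimate (indicatorSeries X x) S m ω := by
  simp only [roundedEstimator, estimate, ofOnesPattern_onesPattern_indicatorSeries]

/-- The detection statistic as a measurable function of the series. -/
noncomputable def seriesStatistic
    (S : (m : ℕ) → (Fin m → EuclideanSpace ℝ (Fin p)) → Matrix (Fin p) (Fin p) ℝ)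
    (η : ℝ) (m : ℕ) (y : ℕ → EuclideanSpace ℝ (Fin p)) : ℝ≥0∞ :=
  tiedDownSup η (roundedEstimator S m y)⁻¹ m fun n => ∑ i ∈ Finset.range n, y i

theorem measurable_seriesStatistic
    (S : (m : ℕ) → (Fin m → EuclideanSpace ℝ (Fin p)) → Matrix (Fin p) (Fin p) ℝ)
    (η : ℝ) (m : ℕ) : Measurable (seriesStatistic S η m) := by
  refine measurable_tiedDownSup η m
    (fun a c => measurable_comp_roundedEstimator S m fun M => M⁻¹ a c) fun i => ?_
  fun_prop

end Rounding

/-- The weighted supremum of the glued Brownian path has the law of the supremum of a single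
Brownian path over a grid. -/
theorem identDistrib_tiedDownSup_glued {Ω Ω' : Type*} [MeasurableSpace Ω] [MeasurableSpace Ω']
    {P : Measure Ω} {P' : Measure Ω'} [IsProbabilityMeasure P] [IsProbabilityMeasure P']
    {W₁ W₂ : ℝ≥0 → Ω → EuclideanSpace ℝ (Fin p)} {W : ℝ≥0 → Ω' → EuclideanSpace ℝ (Fin p)}
    (h₁ : IsStdBrownian W₁ P) (h₂ : IsStdBrownian W₂ P)
    (h₁₂ : IndepFun (fun ω t => W₁ t ω) (fun ω t => W₂ t ω) P) (h : IsStdBrownian W P')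
    (η : ℝ) {m : ℕ} (hm : 1 ≤ m) :
    IdentDistrib
      (fun ω => tiedDownSup η 1 m fun j => W₂ m ω + W₁ ((j - m : ℕ) : ℝ≥0) ω)
      (fun ω => tiedDownSup η 1 m fun j => √m • W (j / m) ω) P P' := by
  let F : (Fin p → ℕ → ℝ) × (Fin p → ℝ) → ℝ≥0∞ := fun x =>
    tiedDownSup η 1 m fun j => WithLp.toLp 2 fun a => x.2 a + x.1 a (j - m)
  have hF : Measurable F := by
    refine measurable_tiedDownSup η m (fun _ _ => measurable_const) fun j => ?_
    fun_prop
  have hglue := (identDistrib_glued_brownian h₁ h₂ h₁₂ h hm).comp hF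
  -- The value at 1 plus the increment after 1 telescopes to √m W(j/m). Truncation in `j - m` is
  -- harmless because only j ≥ m enters.
  refine hglue.trans <| IdentDistrib.of_ae_eq hglue.aemeasurable_snd <|
    Eventually.of_forall fun ω => ?_
  refine tiedDownSup_congr fun j hj => ?_
  have hm0 : (m : ℝ≥0) ≠ 0 := by positivity
  have ht : (1 : ℝ≥0) + ((j - m : ℕ) : ℝ≥0) / m = j / m := by
    rw [← div_self hm0, ← add_div]
    congr 1
    exact_mod_cast Nat.add_sub_cancel' hj
  ext a
  simp only [PiLp.smul_apply, smul_eq_mul, ht]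
  ring

/-- A finite random variable is tight. -/
theorem exists_measure_gt_le {Ω : Type*} [MeasurableSpace Ω] {Q : Measure Ω}
    [IsProbabilityMeasure Q] {Z : Ω → ℝ≥0∞} (hZ : AEMeasurable Z Q) (hfin : ∀ᵐ ω ∂Q, Z ω < ∞)
    {ε : ℝ≥0∞} (hε : 0 < ε) : ∃ C : ℝ, Q {ω | ENNReal.ofReal C < Z ω} ≤ ε := by
  have hlim : Tendsto (fun n : ℕ => Q {ω | (n : ℝ≥0∞) < Z ω}) atTop
      (𝓝 (Q (⋂ n : ℕ, {ω | (n : ℝ≥0∞) < Z ω}))) := by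
    refine tendsto_measure_iInter_atTop (fun n => ?_) (fun n k hnk ω hω => ?_)
      ⟨0, measure_ne_top _ _⟩
    · exact nullMeasurableSet_lt aemeasurable_const hZ
    · exact lt_of_le_of_lt (Nat.cast_le.2 hnk) (Set.mem_ofPred_eq.mp hω)
  have hzero : Q (⋂ n : ℕ, {ω | (n : ℝ≥0∞) < Z ω}) = 0 := by
    refine measure_mono_null (fun ω hω => ?_) (ae_iff.1 hfin)
    intro hlt
    obtain ⟨n, hn⟩ := ENNReal.exists_nat_gt hlt.ne
    exact (lt_asymm hn (Set.mem_iInter.1 hω n)).elim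
  rw [hzero] at hlim
  obtain ⟨n, hn⟩ := (hlim.eventually (ge_mem_nhds hε)).exists
  exact ⟨n, by simpa using hn⟩

end OpenEnd

namespace OpenEnd

/-! ### Passage to the limit. -/

section Limit

variable {p : ℕ} {ΩW : Type*} [MeasurableSpace ΩW] {Q : Measure ΩW}
  {W : ℝ≥0 → ΩW → EuclideanSpace ℝ (Fin p)}

theorem IsStdBrownian.aemeasurable_tiedDownSup_scaled (hW : IsStdBrownian W Q) (η : ℝ) (m : ℕ) :
    AEMeasurable (fun ω => tiedDownSup η 1 m fun j => √m • W (j / m) ω) Q := by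
  have h1 : AEMeasurable (fun ω (j : ℕ) => W (j / m) ω) Q := by
    refine aemeasurable_pi_lambda _ fun j => ?_
    exact (PiLp.continuous_toLp 2 fun _ : Fin p => ℝ).measurable.comp_aemeasurable
      (aemeasurable_pi_lambda _ fun a => (hW.coord a).aemeasurable _)
  have h2 : Measurable fun b : ℕ → EuclideanSpace ℝ (Fin p) =>
      tiedDownSup η 1 m fun j => √m • b j :=
    measurable_tiedDownSup η m (fun _ _ => measurable_const) fun j => by fun_prop
  exact h2.comp_aemeasurable h1

variable [IsProbabilityMeasure Q]

theorem IsStdBrownian.tendstoInDistribution_tiedDownSup_scaled (hW : IsStdBrownian W Q) (η : ℝ) :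
    TendstoInDistribution (fun (m : ℕ) ω => tiedDownSup η 1 m fun j => √m • W (j / m) ω) atTop
      (limitVariable η W) (fun _ => Q) Q := by
  have hlim : ∀ᵐ ω ∂Q, Tendsto (fun m : ℕ => tiedDownSup η 1 m fun j => √m • W (j / m) ω) atTop
      (𝓝 (limitVariable η W ω)) := by
    filter_upwards [hW.ae_continuous] with ω hω using tendsto_tiedDownSup_scaled η W ω hω
  exact tendstoInDistribution_of_ae_tendsto (hW.aemeasurable_tiedDownSup_scaled η)
    (aemeasurable_of_tendsto_metrizable_ae' (hW.aemeasurable_tiedDownSup_scaled η) hlim) hlim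

variable {Ω : Type*} [MeasurableSpace Ω] {P : Measure Ω} [IsProbabilityMeasure P]
  {Y : ℕ → Ω → EuclideanSpace ℝ (Fin p)} {W₁ W₂ : ℕ → ℝ≥0 → Ω → EuclideanSpace ℝ (Fin p)}
  {Sig : Matrix (Fin p) (Fin p) ℝ}

/-- The glued Brownian approximations are tight. -/
theorem exists_eventually_measure_tiedDownSup_glued_le (hW : IsStdBrownian W Q) {η : ℝ}
    (hη : 0 < η)
    (hBM : ∀ m : ℕ, 1 ≤ m → IsStdBrownian (W₁ m) P ∧ IsStdBrownian (W₂ m) P ∧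
      IndepFun (fun ω t => W₁ m t ω) (fun ω t => W₂ m t ω) P) {ε : ℝ≥0∞} (hε : 0 < ε) :
    ∃ C : ℝ, ∀ᶠ m : ℕ in atTop, P {ω | ENNReal.ofReal C <
      tiedDownSup η 1 m fun j => W₂ m m ω + W₁ m ((j - m : ℕ) : ℝ≥0) ω} ≤ ε := by
  obtain ⟨C, hC⟩ := exists_measure_gt_le
    (hW.tendstoInDistribution_tiedDownSup_scaled η).aemeasurable_limit
    (ae_limitVariable_lt_top hW hη) hε
  refine ⟨C, ?_⟩
  filter_upwards [eventually_ge_atTop 1] with m hm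
  obtain ⟨h₁, h₂, h₁₂⟩ := hBM m hm
  have h := (identDistrib_tiedDownSup_glued h₁ h₂ h₁₂ hW η hm).measure_mem_eq
    (measurableSet_Ioi (a := ENNReal.ofReal C))
  -- Every grid supremum is dominated by the same finite limit variable, so one `C` serves all `m`.
  refine (le_of_eq h).trans (le_trans (measure_mono fun ω hω => ?_) hC)
  exact lt_of_lt_of_le hω (tiedDownSup_scaled_le_limitVariable η W ω hm)

/-- The statistic of a strongly approximable series is close to the functional of the
approximating Brownian motions. -/
theorem tendsto_measure_not_close (hW : IsStdBrownian W Q) {η : ℝ} (hη : 0 < η)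
    (hSig : Sig.PosDef)
    (hBM : ∀ m : ℕ, 1 ≤ m → IsStdBrownian (W₁ m) P ∧ IsStdBrownian (W₂ m) P ∧
      IndepFun (fun ω t => W₁ m t ω) (fun ω t => W₂ m t ω) P)
    {ξ : ℝ} (hξ : 0 < ξ) (hξ' : ξ < 1 / 2)
    (h₁ : IsBoundedInProbability P (fun m ω => ⨆ (k : ℕ) (_ : m < k),
      ENNReal.ofReal (1 / ((k : ℝ) - (m : ℝ)) ^ ξ *
        approxError Y P (matrixSqrt Sig) m k (W₁ m ((k - m : ℕ) : ℝ≥0)) ω)))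
    (h₂ : IsBoundedInProbability P (fun m ω =>
      ENNReal.ofReal (1 / (m : ℝ) ^ ξ *
        approxError Y P (matrixSqrt Sig) 0 m (W₂ m (m : ℝ≥0)) ω)))
    {N : ℕ → Ω → Matrix (Fin p) (Fin p) ℝ}
    (hN : ∀ a b : Fin p, TendstoInMeasure P (fun m ω => N m ω a b) atTop (fun _ => Sig a b))
    {δ : ℝ} (hδ : 0 < δ) :
    Tendsto (fun m => P {ω | ¬ (
      tiedDownSup η (N m ω)⁻¹ m (fun n => ∑ i ∈ Finset.range n, Y i ω) ≤
        (tiedDownSup η 1 m fun j => W₂ m m ω + W₁ m ((j - m : ℕ) : ℝ≥0) ω) + ENNReal.ofReal δ ∧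
      (tiedDownSup η 1 m fun j => W₂ m m ω + W₁ m ((j - m : ℕ) : ℝ≥0) ω) ≤
        tiedDownSup η (N m ω)⁻¹ m (fun n => ∑ i ∈ Finset.range n, Y i ω) +
          ENNReal.ofReal δ)}) atTop (𝓝 0) := by
  refine ENNReal.tendsto_nhds_zero.2 fun ε hε => ?_
  have hε4 : 0 < ε / 4 := ENNReal.div_pos hε.ne' (by finiteness)
  obtain ⟨C₁, hC₁⟩ := h₁ _ hε4
  obtain ⟨C₂, hC₂⟩ := h₂ _ hε4
  obtain ⟨C, hC⟩ := exists_eventually_measure_tiedDownSup_glued_le hW hη hBM hε4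
  obtain ⟨r, hr, hclose⟩ := exists_tiedDownSup_close hSig hδ C
  have hNr : Tendsto (fun m => P (⋃ a, ⋃ b, {ω | r ≤ ‖N m ω a b - Sig a b‖})) atTop (𝓝 0) := by
    have hsum : Tendsto (fun m => ∑ a, ∑ b, P {ω | r ≤ ‖N m ω a b - Sig a b‖}) atTop
        (𝓝 (∑ _a : Fin p, ∑ _b : Fin p, 0)) :=
      tendsto_finsetSum _ fun a _ => tendsto_finsetSum _ fun b _ =>
        tendstoInMeasure_iff_norm.1 (hN a b) r hr
    simp only [Finset.sum_const_zero] at hsum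
    refine tendsto_of_tendsto_of_tendsto_of_le_of_le tendsto_const_nhds hsum
      (fun _ => zero_le) fun m => ?_
    refine (measure_iUnion_fintype_le _ _).trans (Finset.sum_le_sum fun a _ => ?_)
    exact measure_iUnion_fintype_le _ _
  have hrate : Tendsto (fun m : ℕ => 2 * ((C₁ + C₂ : ℝ≥0) : ℝ) * (m : ℝ) ^ (-(1 / 2 - ξ))) atTop
      (𝓝 0) := by
    have := (tendsto_rpow_neg_atTop (sub_pos.2 hξ')).comp (tendsto_natCast_atTop_atTop (R := ℝ))
    simpa using this.const_mul (2 * ((C₁ + C₂ : ℝ≥0) : ℝ))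
  filter_upwards [hC₁, hC₂, hC, hNr.eventually (ge_mem_nhds hε4),
    hrate.eventually (gt_mem_nhds hr), eventually_ge_atTop 1] with m b₁ b₂ b₃ b₄ hsmall hm
  -- Brownian motion starts at 0 only almost surely, so the inclusion of the bad event in four
  -- events of probability at most ε/4 is also almost sure.
  have hzero : ∀ᵐ ω ∂P, W₁ m 0 ω = 0 := by
    filter_upwards [ae_all_iff.2 fun a => ((hBM m hm).1.coord a).eval_zero_ae_eq_zero] with ω hω
    ext a
    exact hω a
  refine le_trans (measure_mono_ae (t := (({ω | (C₁ : ℝ≥0∞) < ⨆ (k : ℕ) (_ : m < k),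
      ENNReal.ofReal (1 / ((k : ℝ) - (m : ℝ)) ^ ξ *
        approxError Y P (matrixSqrt Sig) m k (W₁ m ((k - m : ℕ) : ℝ≥0)) ω)} ∪
      {ω | (C₂ : ℝ≥0∞) < ENNReal.ofReal (1 / (m : ℝ) ^ ξ *
        approxError Y P (matrixSqrt Sig) 0 m (W₂ m (m : ℝ≥0)) ω)}) ∪
      {ω | ENNReal.ofReal C <
        tiedDownSup η 1 m fun j => W₂ m m ω + W₁ m ((j - m : ℕ) : ℝ≥0) ω}) ∪
      ⋃ a, ⋃ b, {ω | r ≤ ‖N m ω a b - Sig a b‖}) ?_) ?_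
  · filter_upwards [hzero] with ω hω hbad
    by_contra hgood
    refine hbad ?_
    replace hgood : ω ∉ ((({ω | (C₁ : ℝ≥0∞) < ⨆ (k : ℕ) (_ : m < k),
      ENNReal.ofReal (1 / ((k : ℝ) - (m : ℝ)) ^ ξ *
        approxError Y P (matrixSqrt Sig) m k (W₁ m ((k - m : ℕ) : ℝ≥0)) ω)} ∪
      {ω | (C₂ : ℝ≥0∞) < ENNReal.ofReal (1 / (m : ℝ) ^ ξ *
        approxError Y P (matrixSqrt Sig) 0 m (W₂ m (m : ℝ≥0)) ω)}) ∪
      {ω | ENNReal.ofReal C <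
        tiedDownSup η 1 m fun j => W₂ m m ω + W₁ m ((j - m : ℕ) : ℝ≥0) ω}) ∪
      ⋃ a, ⋃ b, {ω | r ≤ ‖N m ω a b - Sig a b‖}) := hgood
    simp only [Set.mem_union, Set.mem_ofPred_eq, Set.mem_iUnion, not_or, not_exists, not_lt,
      not_le] at hgood
    obtain ⟨⟨⟨g₁, g₂⟩, g₃⟩, g₄⟩ := hgood
    refine hclose η m (N m ω) _ _ g₄ g₃ fun j k hj hk => ?_
    let v := ∫ ω', Y 0 ω' ∂P
    have happrox : ∀ n, m ≤ n → ‖∑ i ∈ Finset.range n, Y i ω - WithLp.toLp 2 (matrixSqrt Sig *ᵥ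
        (W₂ m m ω + W₁ m ((n - m : ℕ) : ℝ≥0) ω).ofLp) - (n : ℝ) • v‖ ≤
        ((C₁ + C₂ : ℝ≥0) : ℝ) * (n : ℝ) ^ ξ := fun n hn =>
      norm_sum_sub_le_of_approx (y := fun i => Y i ω)
        (w₁ := fun n => W₁ m (n : ℝ≥0) ω) hξ hm (by simpa using hω)
        (fun k hk => (le_iSup₂_of_le k hk le_rfl).trans g₁) g₂ hn
    have hle := norm_weight_smul_tiedDown_le (η := η) hη hξ hξ' (NNReal.coe_nonneg (C₁ + C₂)) hm
      happrox hj hk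
    -- The centring `n • v` is a linear drift and drops out of the tied-down path.
    rw [tiedDown_sub_mul (fun n => ∑ i ∈ Finset.range n, Y i ω - WithLp.toLp 2 (matrixSqrt Sig *ᵥ
        (W₂ m m ω + W₁ m ((n - m : ℕ) : ℝ≥0) ω).ofLp)) v] at hle
    exact hle.trans_lt hsmall
  · refine (measure_union_le _ _).trans ?_
    calc _ ≤ (ε / 4 + ε / 4 + ε / 4) + ε / 4 := by
          refine add_le_add ((measure_union_le _ _).trans (add_le_add
            ((measure_union_le _ _).trans (add_le_add b₁ b₂)) b₃)) b₄
      _ = ε := by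
          have h4 : ε / 4 + ε / 4 + ε / 4 + ε / 4 = 4 * (ε / 4) := by ring
          rw [h4, ENNReal.mul_div_cancel (by simp) (by simp)]

/-- Convergence of the statistic on the probability space of the strong approximation. -/
theorem tendstoInDistribution_seriesStatistic (hW : IsStdBrownian W Q) {η : ℝ} (hη : 0 < η)
    (hY : AEMeasurable (fun ω i => Y i ω) P) (hSig : Sig.PosDef)
    (hBM : ∀ m : ℕ, 1 ≤ m → IsStdBrownian (W₁ m) P ∧ IsStdBrownian (W₂ m) P ∧
      IndepFun (fun ω t => W₁ m t ω) (fun ω t => W₂ m t ω) P)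
    {ξ : ℝ} (hξ : 0 < ξ) (hξ' : ξ < 1 / 2)
    (h₁ : IsBoundedInProbability P (fun m ω => ⨆ (k : ℕ) (_ : m < k),
      ENNReal.ofReal (1 / ((k : ℝ) - (m : ℝ)) ^ ξ *
        approxError Y P (matrixSqrt Sig) m k (W₁ m ((k - m : ℕ) : ℝ≥0)) ω)))
    (h₂ : IsBoundedInProbability P (fun m ω =>
      ENNReal.ofReal (1 / (m : ℝ) ^ ξ *
        approxError Y P (matrixSqrt Sig) 0 m (W₂ m (m : ℝ≥0)) ω)))
    (S : (m : ℕ) → (Fin m → EuclideanSpace ℝ (Fin p)) → Matrix (Fin p) (Fin p) ℝ)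
    (hS : ∀ a b : Fin p, TendstoInMeasure P
      (fun m ω => roundedEstimator S m (fun i => Y i ω) a b) atTop (fun _ => Sig a b)) :
    TendstoInDistribution (fun m ω => seriesStatistic S η m (fun i => Y i ω)) atTop
      (limitVariable η W) (fun _ => P) Q := by
  have hX : TendstoInDistribution
      (fun (m : ℕ) ω => tiedDownSup η 1 m fun j => W₂ m m ω + W₁ m ((j - m : ℕ) : ℝ≥0) ω) atTop
      (limitVariable η W) (fun _ => P) Q := by
    refine TendstoInDistribution.of_identDistrib
      (hW.tendstoInDistribution_tiedDownSup_scaled η) fun m => ?_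
    rcases Nat.eq_zero_or_pos m with rfl | hm
    · simp only [tiedDownSup_zero hη]
      exact ⟨aemeasurable_const, aemeasurable_const, by simp⟩
    · obtain ⟨g₁, g₂, g₁₂⟩ := hBM m hm
      exact identDistrib_tiedDownSup_glued g₁ g₂ g₁₂ hW η hm
  exact tendstoInDistribution_of_close hX
    (fun m => (measurable_seriesStatistic S η m).comp_aemeasurable hY)
    fun δ hδ => tendsto_measure_not_close hW hη hSig hBM hξ hξ' h₁ h₂ hS hδ

end Limit

end OpenEnd

theorem theorem1 {Ω : Type u} [MeasurableSpace Ω] (P : Measure Ω) [IsProbabilityMeasure P]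
    {d p : ℕ}
    (X : ℕ → Ω → (Fin d → ℝ)) (hX : ∀ i, Measurable (X i))
    (x : Fin p → (Fin d → ℝ))
    (Sig : Matrix (Fin p) (Fin p) ℝ)
    (happrox : OpenEnd.StrongApproximation.{u, w} (OpenEnd.indicatorSeries X x) P Sig)
    (S : (m : ℕ) → (Fin m → EuclideanSpace ℝ (Fin p)) → Matrix (Fin p) (Fin p) ℝ)
    (hconsistent : ∀ a b : Fin p, TendstoInMeasure P
      (fun m ω => OpenEnd.estimate (OpenEnd.indicatorSeries X x) S m ω a b) atTop
      (fun _ => Sig a b))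
    (η : ℝ) (hη : 0 < η)
    {ΩW : Type v} [MeasurableSpace ΩW] (Q : Measure ΩW) [IsProbabilityMeasure Q]
    (W : ℝ≥0 → ΩW → EuclideanSpace ℝ (Fin p)) (hW : OpenEnd.IsStdBrownian W Q) :
    TendstoInDistribution (fun m : ℕ => OpenEnd.scaledSupDetector X x S η m) atTop
      (OpenEnd.limitVariable η W) (fun _ => P) Q ∧
    ∀ᵐ ω ∂Q, OpenEnd.limitVariable η W ω < ∞ := by
  obtain ⟨Ω', _, P', _, Y', W₁, W₂, hlaw, -, -, hSig, hBM, ξ, hξ, hξ', h₁, h₂⟩ := happrox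
  refine ⟨?_, OpenEnd.ae_limitVariable_lt_top hW hη⟩
  -- Convergence in probability to a constant depends only on the laws, so consistency carries over
  -- to `Y'`; rounding is the identity on the original indicators.
  have hS : ∀ a b : Fin p, TendstoInMeasure P'
      (fun m ω => OpenEnd.roundedEstimator S m (fun i => Y' i ω) a b) atTop
      (fun _ => Sig a b) := by
    intro a b ε hε
    refine (hconsistent a b ε hε).congr fun m => ?_
    have h := (hlaw.comp (OpenEnd.measurable_comp_roundedEstimator S m fun M => M a b)).measure_mem_eq
      (s := {r : ℝ | ε ≤ edist r (Sig a b)})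
      (measurableSet_le measurable_const (by fun_prop))
    simp only [← OpenEnd.roundedEstimator_indicatorSeries]
    exact h.symm
  have hlim := OpenEnd.tendstoInDistribution_seriesStatistic hW hη hlaw.aemeasurable_fst hSig hBM
    hξ hξ' h₁ h₂ S hS
  refine OpenEnd.TendstoInDistribution.of_identDistrib hlim fun m => ?_
  have heq : OpenEnd.scaledSupDetector X x S η m = fun ω =>
      OpenEnd.seriesStatistic S η m fun i => OpenEnd.indicatorSeries X x i ω := by
    ext ω
    rw [OpenEnd.scaledSupDetector_eq_tiedDownSup X x S hη m ω,
      ← OpenEnd.roundedEstimator_indicatorSeries]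
    rfl
  rw [heq]
  exact hlaw.symm.comp (OpenEnd.measurable_seriesStatistic S η m)
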